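/- Let $\mathbb{C}((1/z))$ be the field of formal Laurent series with finitely many positive powers of $z$. Let $\Sigma_3$ be the set of subspaces $V\subset\mathbb{C}((1/z))$ with $z^2V\subset V$ whose nonzero elements have exactly the orders (degrees of the leading power of $z$) $-3,-1,1,3,4,5,\dots$. Let $W_3$ be the set of all subspaces $W\subset\mathbb{C}((1/z))$ spanned by series $$p_j(z)=z^j+H^j_{-2}z^2+H^j_0+\sum_{k\ge1}H^j_kz^{-k},\qquad j=3,4,5,\dots,$$ such that $z^2W\subset W$ and $W\cdot W\subset W$. (1) Every $W\in W_3$ is contained in some $V\in\Sigma_3$. The elements of $W_3$ are exactly the spaces spanned by the polynomials $p_j=z^j+H^j_{-2}z^2+H^j_0$ $(j\ge3)$, where the coefficients satisfy, for all $j\ge5$, $$H^j_{-2}+H^{j-2}_{-2}H^4_{-2}-H^{j-2}_0=0,\qquad H^j_0+H^{j-2}_{-2}H^4_0=0,$$ and $$H^4_0+2H^3_0H^3_{-2}-(H^3_{-2})^2H^4_{-2}-(H^4_{-2})^2=0,\qquad (H^3_0)^2-(H^3_{-2})^2H^4_0-H^4_{-2}H^4_0=0;$$ the coefficients are uniquely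 determined by the space. This family depends on two parameters: for every $(\alpha,\gamma)\in\mathbb{C}^2$ there are one or two solutions $(H^j_{-2},H^j_0)_{j\ge3}$ of the constraints with $H^3_{-2}=\alpha$, $H^4_{-2}=\gamma$. Fix coefficients satisfying these constraints. (2) The $p_j$, $j\ge3$, are a basis of an infinite-dimensional commutative associative algebra, $p_jp_k=\sum_{l\ge3}C^l_{jk}p_l$, with structure constants $$C^l_{jk}=\delta^l_{j+k}+H^k_{-2}\delta^l_{j+2}+H^k_0\delta^l_j+H^j_{-2}\delta^l_{k+2}+H^j_0\delta^l_k+H^j_{-2}H^k_{-2}\delta^l_4,$$ which satisfy $C^l_{jk}=C^l_{kj}$ and $\sum_sC^s_{ij}C^r_{sk}=\sum_sC^s_{jk}C^r_{is}$. (3) Regard $p_3,p_4,\dots$ as independent variables and let $I\subset\mathbb{C}[p_3,p_4,\dots]$ be the ideal generated by the quadrics $p_jp_k-\sum_lC^l_{jk}p_l$, $j,k\ge3$. Then $I$ is the ideal of all polynomial relations between the polynomials $p_j(z)$, and the common zero set of these quadrics is $\{(p_j(t))_{j\ge3}:t\in\mathbb{C}\}$. (4) Write $a=H^3_{-2}$,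 $b=H^3_0$, $c=H^4_{-2}$, $d=H^4_0$. The ideal $I$ contains the polynomial $$\begin{aligned} F={}&p_4^3-p_3^4+4a\,p_3p_4^2-(3c-2a^2)p_3^2p_4-(-4b+2ac)p_3^3-(3d+4ab+a^4+a^2c)p_4^2\\ &-(4a^2b+8ad-2ac^2-6bc-2a^3c)p_3p_4-(-3cd+6b^2-6abc+2a^2d+a^2c^2+c^3)p_3^2\\ &-(-3d^2-2a^2b^2-2a^2cd-2a^4d+3b^2c+2abc^2-8abd+2a^3bc)p_4\\ &-(-4b^3-4ad^2+6bcd-4a^2bd+6ab^2c+2ac^2d+2a^3cd-2a^2bc^2-2bc^3)p_3 . \end{aligned}$$ The plane curve $F=0$ is a $(3,4)$ curve, that is, $F-(p_4^3-p_3^4)$ is a linear combination of monomials $p_3^ip_4^j$ with $3i+4j<12$; it is irreducible and has geometric genus zero. -/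

import Mathlib

noncomputable section

namespace SigmaThree

/-! ### Formal Laurent series in `1/z` and Birkhoff strata of `Gr⁽²⁾` -/

/-- Formal Laurent series with finitely many positive powers of `z`; the variable of
`LaurentSeries` is `1/z`. -/
abbrev Laurent : Type := LaurentSeries ℂ

/-- The coefficient of `z ^ n`. -/
def zcoeff (f : Laurent) (n : ℤ) : ℂ := HahnSeries.coeff f (-n)

/-- The series `z`. -/
def zvar : Laurent := HahnSeries.single (-1 : ℤ) (1 : ℂ)

/-- `f` has order `n`: its leading term is a nonzero multiple of `z ^ n`. -/
def HasOrder (f : Laurent) (n : ℤ) : Prop :=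
  zcoeff f n ≠ 0 ∧ ∀ m : ℤ, n < m → zcoeff f m = 0

/-- `z² · W ⊆ W`. -/
def ZSqStable (W : Submodule ℂ Laurent) : Prop :=
  ∀ f ∈ W, zvar ^ 2 * f ∈ W

/-- `S_m = {-m, -m+2, ..., m-2, m, m+1, m+2, ...}`. -/
def orderSet (m : ℕ) : Set ℤ :=
  {n | (m : ℤ) ≤ n ∨ ∃ i : ℕ, i ≤ m ∧ n = -(m : ℤ) + 2 * (i : ℤ)}

/-- The stratum `Σ_m` of `Gr⁽²⁾`. -/
def stratum (m : ℕ) : Set (Submodule ℂ Laurent) :=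
  {V | ZSqStable V ∧ {n : ℤ | ∃ f ∈ V, HasOrder f n} = orderSet m}

/-! ### The subset `W₃` -/

/-- The indices `3, 4, 5, ...`. -/
abbrev Idx : Type := {j : ℕ // 3 ≤ j}

def i3 : Idx := ⟨3, le_refl 3⟩

def i4 : Idx := ⟨4, by norm_num⟩

def Idx.plus (j k : Idx) : Idx := ⟨j.1 + k.1, le_trans j.2 (Nat.le_add_right _ _)⟩

def Idx.plusTwo (j : Idx) : Idx := ⟨j.1 + 2, le_trans j.2 (Nat.le_add_right _ _)⟩

/-- The form `p_j = z^j + H^j_{-2} z² + H^j_0 + ∑_{k ≥ 1} H^j_k z^{-k}`, `j ≥ 3`, of the elements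
of the canonical basis: the powers `z^n` with `n = 1` or `n ≥ 3` do not occur, except for the
leading `z^j`; the coefficients at `z²`, `z⁰` and at negative powers are arbitrary. -/
def IsCanonical (p : Idx → Laurent) : Prop :=
  ∀ (j : Idx) (n : ℤ), 1 ≤ n → n ≠ 2 → zcoeff (p j) n = if n = (j.1 : ℤ) then 1 else 0

/-- The subset `W₃`: the vector spaces spanned by Laurent series `p_3, p_4, ...` of canonical form
which are stable under `z²` and closed under multiplication. -/
def W3 : Set (Submodule ℂ Laurent) :=
  {W | (∃ p : Idx → Laurent, IsCanonical p ∧ W = Submodule.span ℂ (Set.range p)) ∧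
    ZSqStable W ∧ ∀ f ∈ W, ∀ g ∈ W, f * g ∈ W}

/-- The coefficients `u j = H^j_{-2}` and `v j = H^j_0`, `j ≥ 3`. -/
@[ext]
structure Params where
  u : Idx → ℂ
  v : Idx → ℂ

namespace Params

variable (h : Params)

/-- The linear recursion and the two nonlinear equations satisfied by the `H^j_{-2}, H^j_0`. -/
def Constraints : Prop :=
  (∀ j : Idx, h.u j.plusTwo + h.u j * h.u i4 - h.v j = 0 ∧
    h.v j.plusTwo + h.u j * h.v i4 = 0) ∧
  h.v i4 + 2 * h.v i3 * h.u i3 - h.u i3 ^ 2 * h.u i4 - h.u i4 ^ 2 = 0 ∧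
  h.v i3 ^ 2 - h.u i3 ^ 2 * h.v i4 - h.u i4 * h.v i4 = 0

/-- The polynomial `p_j = z^j + H^j_{-2} z² + H^j_0`. -/
def poly (j : Idx) : Polynomial ℂ :=
  Polynomial.X ^ j.1 + Polynomial.C (h.u j) * Polynomial.X ^ 2 + Polynomial.C (h.v j)

/-- The polynomial `p_j` as a Laurent series. -/
def series (j : Idx) : Laurent := zvar ^ j.1 + h.u j • zvar ^ 2 + h.v j • 1

/-- The vector space spanned by the `p_j`, `j ≥ 3`. -/
def space : Submodule ℂ Laurent := Submodule.span ℂ (Set.range h.series)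

/-- The structure constants
`C_{jk}^l = δ_{j+k}^l + H^k_{-2} δ_{j+2}^l + H^k_0 δ_j^l + H^j_{-2} δ_{k+2}^l + H^j_0 δ_k^l
  + H^j_{-2} H^k_{-2} δ_4^l`, as a finitely supported function of `l`. -/
def structConst (j k : Idx) : Idx →₀ ℂ :=
  Finsupp.single (j.plus k) 1 + Finsupp.single j.plusTwo (h.u k) + Finsupp.single j (h.v k)
    + Finsupp.single k.plusTwo (h.u j) + Finsupp.single k (h.v j)
    + Finsupp.single i4 (h.u j * h.u k)

/-- The quadric `p_j p_k - ∑_l C_{jk}^l p_l` in independent variables `p_3, p_4, ...`. -/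
def quadric (j k : Idx) : MvPolynomial Idx ℂ :=
  MvPolynomial.X j * MvPolynomial.X k
    - (h.structConst j k).sum fun l c => MvPolynomial.C c * MvPolynomial.X l

/-- The ideal generated by the quadrics. -/
def quadricIdeal : Ideal (MvPolynomial Idx ℂ) :=
  Ideal.span {f | ∃ j k : Idx, f = h.quadric j k}

/-- The left-hand side of the equation of the plane curve, in variables `x = p_3`, `y = p_4`. -/
def curve : MvPolynomial (Fin 2) ℂ :=
  let x : MvPolynomial (Fin 2) ℂ := MvPolynomial.X 0
  let y : MvPolynomial (Fin 2) ℂ := MvPolynomial.X 1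
  let a : MvPolynomial (Fin 2) ℂ := MvPolynomial.C (h.u i3)
  let b : MvPolynomial (Fin 2) ℂ := MvPolynomial.C (h.v i3)
  let c : MvPolynomial (Fin 2) ℂ := MvPolynomial.C (h.u i4)
  let d : MvPolynomial (Fin 2) ℂ := MvPolynomial.C (h.v i4)
  y ^ 3 - x ^ 4 + 4 * a * x * y ^ 2
    - (3 * c - 2 * a ^ 2) * x ^ 2 * y
    - (-4 * b + 2 * a * c) * x ^ 3
    - (3 * d + 4 * b * a + a ^ 4 + a ^ 2 * c) * y ^ 2
    - (4 * a ^ 2 * b + 8 * a * d - 2 * a * c ^ 2 - 6 * b * c - 2 * a ^ 3 * c) * x * y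
    - (-3 * d * c + 6 * b ^ 2 - 6 * b * a * c + 2 * a ^ 2 * d + a ^ 2 * c ^ 2 + c ^ 3) * x ^ 2
    - (-3 * d ^ 2 - 2 * b ^ 2 * a ^ 2 - 2 * a ^ 2 * d * c - 2 * a ^ 4 * d + 3 * b ^ 2 * c
        + 2 * b * a * c ^ 2 - 8 * b * a * d + 2 * b * a ^ 3 * c) * y
    - (-4 * b ^ 3 - 4 * a * d ^ 2 + 6 * b * d * c - 4 * b * d * a ^ 2 + 6 * b ^ 2 * a * c
        + 2 * d * a * c ^ 2 + 2 * d * a ^ 3 * c - 2 * b * a ^ 2 * c ^ 2 - 2 * b * c ^ 3) * x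

end Params

/-! ### Plane curves -/

/-- An `(n, s)` curve: `n, s` are coprime and the equation is `y^n - x^s` plus a linear combination
of monomials `x^i y^j` with `n i + s j < n s`. -/
def IsNSCurve (n s : ℕ) (F : MvPolynomial (Fin 2) ℂ) : Prop :=
  Nat.Coprime n s ∧
  ∀ m ∈ (F - (MvPolynomial.X 1 ^ n - MvPolynomial.X 0 ^ s)).support, n * m 0 + s * m 1 < n * s

/-- The differentials of a field `K` over `ℂ` that are regular at every place of `K`, that is, lie
in the image of `Ω[O⁄ℂ]` for each valuation ring `O` of `K` containing `ℂ`. If `K` is the function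
field of a curve, these are the global regular differentials of its smooth projective model. -/
def regularDifferentials (K : Type) [Field K] [Algebra ℂ K] :
    Submodule ℂ (KaehlerDifferential ℂ K) :=
  ⨅ O : {O : ValuationSubring K // ∀ c : ℂ, algebraMap ℂ K c ∈ O},
    Submodule.span ℂ {w | ∃ f ∈ O.1, ∃ g ∈ O.1, w = f • KaehlerDifferential.D ℂ K g}

/-- The (geometric) genus of the irreducible plane curve `F = 0`: the dimension of the space of
regular differentials of its function field. -/
def genus (F : MvPolynomial (Fin 2) ℂ) [(Ideal.span {F}).IsPrime] : Cardinal :=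
  Module.rank ℂ
    (regularDifferentials (FractionRing (MvPolynomial (Fin 2) ℂ ⧸ Ideal.span {F})))

end SigmaThree

end

/-!
An element of `W` is determined by its coefficients at `z³, z⁴, …`, so stability under `z²` forces
`z² p_j = p_{j+2} + u_j p_4` with `u_j = H^j_{-2}`, and everything is determined by `p_3` and `p_4`.
Parity in `z` and closure under multiplication then kill all negative powers, and closure of the
span of the resulting polynomials reduces to the single condition `p_3² ∈ W`.

Modulo the quadrics every polynomial in the `p_j` is a linear polynomial, and `1, p_3, p_4, …` are
linearly independent by degree: this identifies the ideal of relations. A common zero of the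
quadrics is a point of the subalgebra of `ℂ[z]` generated by the `p_j`, over which `ℂ[z]` is
integral, so it lifts to a point of the line. The curve `F = 0` is parametrised by `(p_3, p_4)`,
of coprime degrees `3` and `4`; comparing degrees of remainders modulo `F` shows that `F` generates
the kernel. Finally `z` is a quotient of polynomials in `p_3` and `p_4`, so the function field
of the curve is `ℂ(z)`, which has no nonzero regular differentials.
-/

noncomputable section

namespace SigmaThree

open Polynomial

theorem ncard_setOf_sq_add_mul_add_eq_zero {k : Type*} [Field k] [IsAlgClosed k] (p q : k) :
    {b : k | b ^ 2 + p * b + q = 0}.ncard = 1 ∨ {b : k | b ^ 2 + p * b + q = 0}.ncard = 2 := by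
  obtain ⟨r, hr⟩ : ∃ r, r ^ 2 + p * r + q = 0 := by
    have hdeg : (X ^ 2 + C p * X + C q).degree = 2 := by compute_degree!
    obtain ⟨r, hr⟩ := IsAlgClosed.exists_root _ (hdeg.trans_ne two_ne_zero)
    exact ⟨r, by simpa [IsRoot] using hr⟩
  have hset : {b : k | b ^ 2 + p * b + q = 0} = {r, -p - r} := by
    ext b
    have hfactor : b ^ 2 + p * b + q = (b - r) * (b - (-p - r)) := by linear_combination hr
    simp [hfactor, sub_eq_zero]
  rw [hset]
  obtain h | h := eq_or_ne r (-p - r)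
  · exact .inl (by rw [← h, Set.pair_eq_singleton, Set.ncard_singleton])
  · exact .inr (Set.ncard_pair h)

/-! ### Algebras presented by quadrics -/

section Quadrics

variable {σ R A : Type*} [CommRing R] [CommRing A] [Algebra R A]

theorem restrictScalars_sup_span_eq_top {I : Ideal (MvPolynomial σ R)}
    (hI : ∀ j k, MvPolynomial.X j * MvPolynomial.X k ∈ I.restrictScalars R ⊔
      Submodule.span R (Set.range fun o : Option σ => o.elim 1 MvPolynomial.X)) :
    I.restrictScalars R ⊔
      Submodule.span R (Set.range fun o : Option σ => o.elim 1 MvPolynomial.X) = ⊤ := by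
  set S := Submodule.span R
    (Set.range fun o : Option σ => o.elim (1 : MvPolynomial σ R) MvPolynomial.X)
  have hS (o : Option σ) : o.elim (1 : MvPolynomial σ R) MvPolynomial.X ∈ S :=
    Submodule.subset_span ⟨o, rfl⟩
  have hmul_X : ∀ s ∈ S, ∀ k, s * MvPolynomial.X k ∈ I.restrictScalars R ⊔ S := by
    intro s hs k
    induction hs using Submodule.span_induction with
    | mem _ hx =>
      obtain ⟨_ | j, rfl⟩ := hx
      · simpa using Submodule.mem_sup_right (hS (some k))
      · exact hI j k
    | zero => simp
    | add x y _ _ hx hy => simpa only [add_mul] using add_mem hx hy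
    | smul c x _ hx => simpa only [smul_mul_assoc] using Submodule.smul_mem _ c hx
  rw [Submodule.eq_top_iff']
  intro f
  induction f using MvPolynomial.induction_on with
  | C c =>
    simpa [MvPolynomial.smul_eq_C_mul]
      using Submodule.mem_sup_right (Submodule.smul_mem _ c (hS none))
  | add f g hf hg => exact add_mem hf hg
  | mul_X f k hf =>
    obtain ⟨i, hi, s, hs, rfl⟩ := Submodule.mem_sup.mp hf
    rw [add_mul]
    exact add_mem (Submodule.mem_sup_left (I.mul_mem_right _ hi)) (hmul_X s hs k)

theorem eq_ker_aeval_of_quadratic {I : Ideal (MvPolynomial σ R)} {g : σ → A}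
    (hle : I ≤ RingHom.ker (MvPolynomial.aeval g : MvPolynomial σ R →ₐ[R] A))
    (hI : ∀ j k, MvPolynomial.X j * MvPolynomial.X k ∈ I.restrictScalars R ⊔
      Submodule.span R (Set.range fun o : Option σ => o.elim 1 MvPolynomial.X))
    (hg : LinearIndependent R fun o : Option σ => o.elim 1 g) :
    I = RingHom.ker (MvPolynomial.aeval g : MvPolynomial σ R →ₐ[R] A) := by
  refine le_antisymm hle fun f hf => ?_
  obtain ⟨i, hi, s, hs, rfl⟩ := Submodule.mem_sup.mp
    ((restrictScalars_sup_span_eq_top hI).ge (Submodule.mem_top (x := f)))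
  obtain ⟨c, rfl⟩ := (Finsupp.mem_span_range_iff_exists_finsupp).mp hs
  have hs : MvPolynomial.aeval g
      (c.sum fun o a => a • o.elim (1 : MvPolynomial σ R) MvPolynomial.X) = 0 := by
    simpa [RingHom.mem_ker.mp (hle hi)] using hf
  have hlin : Finsupp.linearCombination R (fun o : Option σ => o.elim 1 g) c = 0 := by
    rw [← hs, Finsupp.linearCombination_apply, map_finsuppSum]
    refine Finsupp.sum_congr fun o _ => ?_
    cases o <;> simp
  rw [linearIndependent_iff.mp hg c hlin]
  simpa using hi

end Quadrics

/-! ### Curves parametrised by polynomials -/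

section Parametrisation

variable {R A : Type*} [CommRing R] [CommRing A] [Algebra R A]

theorem isIntegral_of_monic {φ : A →ₐ[R] R[X]} {a : A} (ha : (φ a).Monic)
    (hdeg : 0 < (φ a).natDegree) : (φ : A →+* R[X]).IsIntegral := by
  have : Nontrivial R[X] := nontrivial_of_ne (φ a) 0 fun h => by simp [h] at hdeg
  have := (φ : A →+* R[X]).domain_nontrivial
  have hX : (φ : A →+* R[X]).IsIntegralElem X := by
    refine ⟨(φ a).map (algebraMap R A) - C a, ?_, ?_⟩
    · exact (ha.map _).sub_of_left (degree_C_le.trans_lt (natDegree_pos_iff_degree_pos.mp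
        ((ha.natDegree_map (algebraMap R A)).symm ▸ hdeg)))
    · have hC : (φ : A →+* R[X]).comp (algebraMap R A) = C := RingHom.ext φ.commutes
      rw [eval₂_sub, eval₂_map, eval₂_C, hC, eval₂_C_X, AlgHom.coe_toRingHom, sub_self]
  intro P
  have hC (c : R) : (φ : A →+* R[X]).IsIntegralElem (C c) := by
    simpa using (φ : A →+* R[X]).isIntegralElem_map (x := algebraMap R A c)
  induction P using Polynomial.induction_on with
  | C c => exact hC c
  | add P Q hP hQ => exact hP.add _ hQ
  | monomial n c ih => simpa only [pow_succ, mul_assoc] using ih.mul _ hX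

theorem exists_eval_eq_of_isIntegral {k : Type*} [Field k] [IsAlgClosed k] [Algebra k A]
    {φ : A →ₐ[k] k[X]} (hφ : (φ : A →+* k[X]).IsIntegral)
    {ε : A →ₐ[k] k} (hker : RingHom.ker φ ≤ RingHom.ker ε) :
    ∃ t : k, ∀ f, ε f = (φ f).eval t := by
  algebraize [(φ : A →+* k[X])]
  have : (RingHom.ker ε).IsMaximal :=
    RingHom.ker_isMaximal_of_surjective ε fun c => ⟨algebraMap k A c, ε.commutes c⟩
  obtain ⟨Q, hQ, hcomap⟩ := Ideal.exists_ideal_over_maximal_of_isIntegral (S := k[X])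
    (RingHom.ker ε) hker
  obtain ⟨g, rfl⟩ : ∃ g, Q = Ideal.span {g} := ⟨_, (Ideal.span_singleton_generator Q).symm⟩
  have hdeg : g.degree ≠ 0 := fun hg => hQ.ne_top
    (Ideal.span_singleton_eq_top.mpr (isUnit_iff_degree_eq_zero.mpr hg))
  obtain ⟨t, ht⟩ := IsAlgClosed.exists_root g hdeg
  refine ⟨t, fun f => ?_⟩
  have hmem : f - algebraMap k A (ε f) ∈ RingHom.ker ε := by simp [RingHom.mem_ker]
  rw [← hcomap, Ideal.mem_comap, Ideal.mem_span_singleton] at hmem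
  have hroot : (φ (f - algebraMap k A (ε f))).eval t = 0 := ht.dvd hmem
  rw [map_sub, φ.commutes, algebraMap_eq, eval_sub, eval_C] at hroot
  exact (sub_eq_zero.mp hroot).symm

theorem eq_zero_of_sum_eq_zero_of_degree_injective {ι : Type*} {s : Finset ι} {f : ι → R[X]}
    (hs : ∑ i ∈ s, f i = 0)
    (hf : ∀ i ∈ s, ∀ j ∈ s, f i ≠ 0 → f j ≠ 0 → (f i).natDegree = (f j).natDegree → i = j)
    {i : ι} (hi : i ∈ s) : f i = 0 := by
  have hdeg := degree_sum_eq_of_disjoint f s fun i hi j hj hij h =>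
    hij (hf i hi.1 j hj.1 hi.2 hj.2 (natDegree_eq_of_degree_eq h))
  rw [hs, degree_zero] at hdeg
  exact degree_eq_bot.mp ((Finset.sup_eq_bot_iff _ _).mp hdeg.symm i hi)

variable (R) in
/-- A polynomial in `x = X 0` and `y = X 1`, as a polynomial in `x` over `R[y]`. -/
def bivariateEquiv : MvPolynomial (Fin 2) R ≃ₐ[R] R[X][X] :=
  (MvPolynomial.finSuccEquiv R 1).trans
    (Polynomial.mapAlgEquiv (MvPolynomial.uniqueAlgEquiv R (Fin 1)))

theorem bivariateEquiv_X_zero : bivariateEquiv R (MvPolynomial.X 0) = X := by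
  simp [bivariateEquiv, MvPolynomial.finSuccEquiv_X_zero]

theorem bivariateEquiv_X_one : bivariateEquiv R (MvPolynomial.X 1) = C X := by
  have h : MvPolynomial.finSuccEquiv R 1 (MvPolynomial.X 1) = C (MvPolynomial.X 0) :=
    MvPolynomial.finSuccEquiv_X_succ (j := 0)
  simp [bivariateEquiv, h]

theorem bivariateEquiv_C (c : R) : bivariateEquiv R (MvPolynomial.C c) = C (C c) :=
  (bivariateEquiv R).commutes c

theorem degree_bivariateEquiv_lt {s : ℕ} {G : MvPolynomial (Fin 2) R}
    (hG : ∀ m ∈ G.support, m 0 < s) :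
    (bivariateEquiv R G).degree < s := by
  rw [← mem_degreeLT, ← G.support_sum_monomial_coeff, map_sum]
  refine Submodule.sum_mem _ fun m hm => ?_
  rw [MvPolynomial.monomial_eq, Finsupp.prod_fintype _ _ fun i => pow_zero _, Fin.prod_univ_two,
    map_mul, map_mul, map_pow, map_pow, bivariateEquiv_C, bivariateEquiv_X_zero,
    bivariateEquiv_X_one, mul_left_comm, ← C_pow, ← C_mul, mul_comm, mem_degreeLT]
  exact (degree_C_mul_X_pow_le _ _).trans_lt (by exact_mod_cast hG m hm)

variable [IsDomain R]

theorem linearIndependent_of_natDegree_injective {ι : Type*} {f : ι → R[X]}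
    (h0 : ∀ i, f i ≠ 0) (hf : Function.Injective fun i => (f i).natDegree) :
    LinearIndependent R f := by
  rw [linearIndependent_iff']
  intro s g hs i hi
  have hterm := eq_zero_of_sum_eq_zero_of_degree_injective hs (fun i _ j _ hi hj hij => ?_) hi
  · exact (smul_eq_zero.mp hterm).resolve_right (h0 i)
  · rw [natDegree_smul _ (smul_ne_zero_iff.mp hi).1, natDegree_smul _ (smul_ne_zero_iff.mp hj).1]
      at hij
    exact hf hij

/-- The degrees of the terms `rᵢ(p) qⁱ`, `i < deg p`, are distinct modulo `deg p`. -/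
theorem eq_zero_of_eval₂_compRingHom_eq_zero {p q : R[X]} {r : R[X][X]}
    (hpq : p.natDegree.Coprime q.natDegree) (hr : r.natDegree < p.natDegree)
    (h0 : r.eval₂ (compRingHom p) q = 0) : r = 0 := by
  have hq (i : ℕ) (hi : i < p.natDegree) : q ^ i ≠ 0 := by
    obtain rfl | hq := eq_or_ne q 0
    · obtain rfl : i = 0 := by simp at hpq; omega
      simp
    · exact pow_ne_zero i hq
  have hcomp (a : R[X]) : compRingHom p a = a.comp p := rfl
  have hterm (i : ℕ) (hi : i < p.natDegree) : (r.coeff i).comp p * q ^ i = 0 := by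
    refine eq_zero_of_sum_eq_zero_of_degree_injective (s := Finset.range p.natDegree)
      (f := fun i => (r.coeff i).comp p * q ^ i) ?_ (fun i hi j hj hfi hfj h => ?_)
      (Finset.mem_range.mpr hi)
    · simpa only [eval₂_eq_sum_range' _ hr, hcomp] using h0
    · simp only [natDegree_mul (left_ne_zero_of_mul hfi) (right_ne_zero_of_mul hfi),
        natDegree_mul (left_ne_zero_of_mul hfj) (right_ne_zero_of_mul hfj), natDegree_comp,
        natDegree_pow] at h
      have hmod : i * q.natDegree ≡ j * q.natDegree [MOD p.natDegree] := by
        simpa [Nat.ModEq] using congrArg (· % p.natDegree) h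
      exact (Nat.ModEq.cancel_right_of_coprime hpq hmod).eq_of_lt_of_lt
        (Finset.mem_range.mp hi) (Finset.mem_range.mp hj)
  ext1 i
  obtain hi | hi := lt_or_ge i p.natDegree
  · obtain hz | ⟨-, hp⟩ :=
      comp_eq_zero_iff.mp ((mul_eq_zero.mp (hterm i hi)).resolve_right (hq i hi))
    · exact hz
    · rw [hp, natDegree_C] at hi
      exact absurd hi (Nat.not_lt_zero i)
  · exact coeff_eq_zero_of_natDegree_lt (hr.trans_le hi)

theorem ker_eval₂RingHom_compRingHom_eq_span {p q : R[X]} {G : R[X][X]}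
    (hpq : p.natDegree.Coprime q.natDegree) (hp : 0 < p.natDegree) (hG : G.Monic)
    (hdeg : G.natDegree = p.natDegree) (h0 : G.eval₂ (compRingHom p) q = 0) :
    RingHom.ker (eval₂RingHom (compRingHom p) q) = Ideal.span {G} := by
  refine le_antisymm (fun f hf => ?_) ((Ideal.span_singleton_le_iff_mem _).mpr h0)
  have hmod : f %ₘ G = 0 := by
    refine eq_zero_of_eval₂_compRingHom_eq_zero hpq ?_ ?_
    · rw [← hdeg]
      exact natDegree_modByMonic_lt f hG fun h => by simp [h] at hdeg; omega
    · rw [modByMonic_eq_sub_mul_div, eval₂_sub, eval₂_mul, h0, zero_mul, sub_zero]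
      exact hf
  exact Ideal.mem_span_singleton.mpr ((modByMonic_eq_zero_iff_dvd hG).mp hmod)

theorem ker_aeval_pair_eq_span {p q : R[X]} {F : MvPolynomial (Fin 2) R}
    (hpq : p.natDegree.Coprime q.natDegree) (hq : 0 < q.natDegree)
    (hF : (bivariateEquiv R F).Monic) (hdeg : (bivariateEquiv R F).natDegree = q.natDegree)
    (h0 : MvPolynomial.aeval ![p, q] F = 0) :
    RingHom.ker (MvPolynomial.aeval ![p, q] : MvPolynomial (Fin 2) R →ₐ[R] R[X])
      = Ideal.span {F} := by
  have hcomp (f : MvPolynomial (Fin 2) R) :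
      (bivariateEquiv R f).eval₂ (compRingHom q) p = MvPolynomial.aeval ![p, q] f := by
    induction f using MvPolynomial.induction_on with
    | C c => simp [bivariateEquiv_C]
    | add f g hf hg => rw [map_add, eval₂_add, hf, hg, map_add]
    | mul_X f i hf =>
      rw [map_mul, eval₂_mul, hf, map_mul]
      fin_cases i <;> simp [bivariateEquiv_X_zero, bivariateEquiv_X_one]
  ext f
  rw [RingHom.mem_ker, ← hcomp]
  change bivariateEquiv R f ∈ RingHom.ker (eval₂RingHom (compRingHom q) p) ↔ _
  rw [ker_eval₂RingHom_compRingHom_eq_span hpq.symm hq hF hdeg (by rw [hcomp, h0]),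
    Ideal.mem_span_singleton, Ideal.mem_span_singleton, map_dvd_iff]

end Parametrisation

/-! ### Differentials of a rational function field -/

section RationalFunctionField

open IsDedekindDomain IntermediateField
open scoped KaehlerDifferential

section Places

variable {k K : Type*} [Field k] [Field K] [Algebra k K] [Algebra k[X] K] [IsScalarTower k k[X] K]

theorem D_algebraMap_polynomial (P : k[X]) : KaehlerDifferential.D k K (algebraMap k[X] K P) =
    algebraMap k[X] K (derivative P) • KaehlerDifferential.D k K (algebraMap k[X] K X) := by
  have h (Q : k[X]) : algebraMap k[X] K Q = aeval (algebraMap k[X] K X) Q := by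
    rw [aeval_algebraMap_apply, aeval_X_left_apply]
  rw [h P, h (derivative P), Derivation.map_aeval]

variable [IsFractionRing k[X] K]

theorem D_algebraMap_X_ne_zero : KaehlerDifferential.D k K (algebraMap k[X] K X) ≠ 0 := by
  intro h
  rw [← KaehlerDifferential.map_D k k k[X] K, ← map_zero (KaehlerDifferential.map k k k[X] K),
    IsLocalizedModule.eq_iff_exists (nonZeroDivisors k[X])] at h
  obtain ⟨P, hP⟩ := h
  have hP := congrArg (KaehlerDifferential.polynomialEquiv k) hP
  simp [Submonoid.smul_def] at hP

theorem exists_D_eq_smul_of_valuation_le_one (v : HeightOneSpectrum k[X]) {g : K}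
    (hg : v.valuation K g ≤ 1) : ∃ c : K, v.valuation K c ≤ 1 ∧
      KaehlerDifferential.D k K g = c • KaehlerDifferential.D k K (algebraMap k[X] K X) := by
  obtain ⟨n, ⟨d, hd⟩, hgd⟩ := v.exists_primeCompl_mul_eq_of_integer (K := K) g hg
  have hvd : v.valuation K (algebraMap k[X] K d) = 1 := v.valuation_eq_one_iff_notMem.mpr hd
  have hd0 : algebraMap k[X] K d ≠ 0 := fun h => by simp [h] at hvd
  refine ⟨(algebraMap k[X] K d)⁻¹ *
    (algebraMap k[X] K (derivative n) - g * algebraMap k[X] K (derivative d)), ?_, ?_⟩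
  · rw [map_mul, map_inv₀, hvd, inv_one, one_mul]
    refine (Valuation.map_sub _ _ _).trans (max_le (v.valuation_le_one _) ?_)
    rw [map_mul]
    exact mul_le_one' hg (v.valuation_le_one _)
  · have h := congrArg (KaehlerDifferential.D k K) hgd
    rw [Derivation.leibniz, D_algebraMap_polynomial n, D_algebraMap_polynomial d] at h
    rw [mul_smul, sub_smul, mul_smul, ← h, add_sub_cancel_left, smul_smul, inv_mul_cancel₀ hd0,
      one_smul]

end Places

theorem exists_eq_smul_D_of_mem_regularDifferentials {K : Type} [Field K] [Algebra ℂ K]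
    [Algebra ℂ[X] K] [IsScalarTower ℂ ℂ[X] K] [IsFractionRing ℂ[X] K] {w : Ω[K⁄ℂ]}
    (hw : w ∈ regularDifferentials K) : ∃ P : ℂ[X],
      w = algebraMap ℂ[X] K P • KaehlerDifferential.D ℂ K (algebraMap ℂ[X] K X) := by
  have hlocal (v : HeightOneSpectrum ℂ[X]) : ∃ c : K, v.valuation K c ≤ 1 ∧
      w = c • KaehlerDifferential.D ℂ K (algebraMap ℂ[X] K X) := by
    have hconst (a : ℂ) : v.valuation K (algebraMap ℂ K a) ≤ 1 := by
      rw [IsScalarTower.algebraMap_apply ℂ ℂ[X] K]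
      exact v.valuation_le_one _
    have hwv := (Submodule.mem_iInf _).mp hw ⟨(v.valuation K).valuationSubring, hconst⟩
    clear hw
    induction hwv using Submodule.span_induction with
    | mem _ hx =>
      obtain ⟨f, hf, g, hg, rfl⟩ := hx
      obtain ⟨c, hc, hDg⟩ := exists_D_eq_smul_of_valuation_le_one v hg
      exact ⟨f * c, by simpa using mul_le_one' hf hc, by rw [hDg, mul_smul]⟩
    | zero => exact ⟨0, by simp, by simp⟩
    | add x y _ _ hx hy =>
      obtain ⟨c, hc, rfl⟩ := hx
      obtain ⟨c', hc', rfl⟩ := hy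
      exact ⟨c + c', (Valuation.map_add _ _ _).trans (max_le hc hc'), (add_smul _ _ _).symm⟩
    | smul a x _ hx =>
      obtain ⟨c, hc, rfl⟩ := hx
      refine ⟨algebraMap ℂ K a * c, by simpa using mul_le_one' (hconst a) hc, ?_⟩
      rw [mul_smul, algebraMap_smul]
  obtain ⟨c, -, hc⟩ := hlocal (Polynomial.idealX ℂ)
  obtain ⟨P, hP⟩ := HeightOneSpectrum.mem_integers_of_valuation_le_one K c fun v => by
    obtain ⟨c', hc', hwc'⟩ := hlocal v
    rwa [smul_left_injective K D_algebraMap_X_ne_zero (hc.symm.trans hwc')]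
  exact ⟨P, by rw [hc, ← hP]⟩

section Generator

variable {k K : Type*} [Field k] [Field K] [Algebra k K] {z : K}

theorem ne_zero_of_transcendental (hz : Transcendental k z) : z ≠ 0 :=
  fun h => hz (h ▸ isAlgebraic_zero)

theorem aeval_inv_mul_pow_natDegree (hz : z ≠ 0) (P : k[X]) :
    aeval z⁻¹ P * z ^ P.natDegree = aeval z P.reverse := by
  let _ : Invertible z⁻¹ := invertibleOfNonzero (inv_ne_zero hz)
  have h := eval₂_reverse_mul_pow (algebraMap k K) z⁻¹ P
  rw [invOf_eq_inv, inv_inv] at h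
  rw [aeval_def, aeval_def, ← h, mul_assoc, ← mul_pow, inv_mul_cancel₀ hz, one_pow, mul_one]

theorem natDegree_eq_zero_of_aeval_eq_aeval_inv (hz : Transcendental k z) {P Q : k[X]}
    (h : aeval z P = aeval z⁻¹ Q) : P.natDegree = 0 := by
  obtain rfl | hP := eq_or_ne P 0
  · exact natDegree_zero
  have hz0 := ne_zero_of_transcendental hz
  have hrev : P * X ^ Q.natDegree = Q.reverse := by
    refine transcendental_iff_injective.mp hz ?_
    rw [map_mul, h, aeval_X_pow, aeval_inv_mul_pow_natDegree hz0]
  have hdeg := Q.reverse_natDegree_le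
  rw [← hrev, natDegree_mul_X_pow _ hP] at hdeg
  omega

variable (k z) in
/-- `K` is the field of rational functions in `z` over `k`. -/
structure IsRationalGenerator : Prop where
  transcendental : Transcendental k z
  adjoin_eq_top : k⟮z⟯ = ⊤

namespace IsRationalGenerator

theorem inv (hz : IsRationalGenerator k z) : IsRationalGenerator k z⁻¹ where
  transcendental h := hz.transcendental (IsAlgebraic.inv_iff.mp h)
  adjoin_eq_top := by
    rw [eq_top_iff, ← hz.adjoin_eq_top, adjoin_simple_le_iff]
    simpa using inv_mem (mem_adjoin_simple_self k z⁻¹)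

theorem isFractionRing (hz : IsRationalGenerator k z) :
    letI := (aeval z : k[X] →ₐ[k] K).toAlgebra
    IsFractionRing k[X] K := by
  let _ := (aeval z : k[X] →ₐ[k] K).toAlgebra
  have hinj : Function.Injective (algebraMap k[X] K) :=
    transcendental_iff_injective.mp hz.transcendental
  have := (faithfulSMul_iff_algebraMap_injective k[X] K).mpr hinj
  refine IsFractionRing.of_field _ _ fun f => ?_
  have hf : f ∈ k⟮z⟯ := by simp [hz.adjoin_eq_top]
  obtain ⟨P, Q, rfl⟩ := mem_adjoin_simple_iff k f |>.mp hf
  exact ⟨P, Q, rfl⟩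

end IsRationalGenerator

end Generator

namespace IsRationalGenerator

variable {K : Type} [Field K] [Algebra ℂ K] {z : K}

theorem D_ne_zero (hz : IsRationalGenerator ℂ z) : KaehlerDifferential.D ℂ K z ≠ 0 := by
  let _ := (aeval z : ℂ[X] →ₐ[ℂ] K).toAlgebra
  have := hz.isFractionRing
  simpa [RingHom.algebraMap_toAlgebra] using D_algebraMap_X_ne_zero (k := ℂ) (K := K)

theorem exists_eq_aeval_smul_D (hz : IsRationalGenerator ℂ z) {w : Ω[K⁄ℂ]}
    (hw : w ∈ regularDifferentials K) :
    ∃ P : ℂ[X], w = aeval z P • KaehlerDifferential.D ℂ K z := by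
  let _ := (aeval z : ℂ[X] →ₐ[ℂ] K).toAlgebra
  have := hz.isFractionRing
  simpa [RingHom.algebraMap_toAlgebra] using exists_eq_smul_D_of_mem_regularDifferentials hw

/-- At infinity `1 / z` is a local parameter and `P(z) dz = -z² P(z) d(1/z)`, so `z² P(z)` has to be
a polynomial in `1 / z`. -/
theorem regularDifferentials_eq_bot (hz : IsRationalGenerator ℂ z) :
    regularDifferentials K = ⊥ := by
  rw [eq_bot_iff]
  intro w hw
  have hz0 := ne_zero_of_transcendental hz.transcendental
  obtain ⟨P, hP⟩ := hz.exists_eq_aeval_smul_D hw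
  obtain ⟨Q, hQ⟩ := hz.inv.exists_eq_aeval_smul_D hw
  have hPQ : aeval z P = aeval z⁻¹ Q * -(z⁻¹) ^ 2 := by
    refine smul_left_injective K hz.D_ne_zero ?_
    simp only [mul_smul, ← hP, hQ, Derivation.leibniz_inv]
  have hdeg : (P * X ^ 2).natDegree = 0 := by
    refine natDegree_eq_zero_of_aeval_eq_aeval_inv hz.transcendental (Q := -Q) ?_
    rw [map_mul, aeval_X_pow, hPQ, map_neg]
    field_simp
  obtain rfl : P = 0 := by
    by_contra hP0
    rw [natDegree_mul_X_pow _ hP0] at hdeg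
    omega
  simpa using hP

end IsRationalGenerator

theorem isRationalGenerator_div_of_parametrisation {k Q K : Type*} [Field k] [CommRing Q]
    [Algebra k Q] [Field K] [Algebra Q K] [Algebra k K] [IsScalarTower k Q K]
    [IsFractionRing Q K] {ψ : Q →ₐ[k] k[X]} (hψ : Function.Injective ψ) {β γ : Q} (hγ : γ ≠ 0)
    (hβ : ψ β = X * ψ γ) : IsRationalGenerator k (algebraMap Q K β / algebraMap Q K γ) := by
  set z := algebraMap Q K β / algebraMap Q K γ
  have : IsDomain Q := hψ.isDomain ψ.toRingHom
  have hinj : Function.Injective ((IsScalarTower.toAlgHom k k[X] (RatFunc k)).comp ψ) :=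
    (RatFunc.algebraMap_injective k).comp hψ
  let θ : K →ₐ[k] RatFunc k := IsFractionRing.liftAlgHom hinj
  have hθ (q : Q) : θ (algebraMap Q K q) = algebraMap k[X] (RatFunc k) (ψ q) :=
    IsFractionRing.lift_algebraMap hinj q
  have hθz : θ z = RatFunc.X := by
    have hψγ : algebraMap k[X] (RatFunc k) (ψ γ) ≠ 0 :=
      RatFunc.algebraMap_ne_zero ((map_ne_zero_iff ψ hψ).mpr hγ)
    rw [map_div₀, hθ, hθ, hβ, map_mul, mul_div_cancel_right₀ _ hψγ, RatFunc.algebraMap_X]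
  have haeval (q : Q) : algebraMap Q K q = aeval z (ψ q) := by
    apply θ.toRingHom.injective
    change θ _ = θ _
    rw [hθ, ← aeval_algHom_apply, hθz, ← RatFunc.algebraMap_X, aeval_algebraMap_apply,
      aeval_X_left_apply]
  refine ⟨fun halg => RatFunc.transcendental_X (hθz ▸ halg.algHom θ), ?_⟩
  rw [eq_top_iff]
  intro f _
  obtain ⟨q, s, -, rfl⟩ := IsFractionRing.div_surjective (A := Q) f
  exact (mem_adjoin_simple_iff k _).mpr ⟨ψ q, ψ s, by rw [haeval, haeval]⟩

end RationalFunctionField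

/-! ### Laurent series in `1/z` -/

section LaurentSeries

instance : IsScalarTower ℂ Laurent Laurent where
  smul_assoc c f g := by
    simp only [smul_eq_mul, ← HahnSeries.C_mul_eq_smul, mul_assoc]

instance : SMulCommClass ℂ Laurent Laurent where
  smul_comm c f g := by
    simp only [smul_eq_mul, ← HahnSeries.C_mul_eq_smul, mul_left_comm]

theorem laurent_ext {f g : Laurent} (h : ∀ n, zcoeff f n = zcoeff g n) : f = g :=
  HahnSeries.ext (funext fun n => by simpa [zcoeff] using h (-n))

/-- The coefficient of `z ^ n`, as a linear functional. -/
def zcoeffLinear (n : ℤ) : Laurent →ₗ[ℂ] ℂ := HahnSeries.coeff.linearMap (-n)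

theorem zcoeffLinear_apply (n : ℤ) (f : Laurent) : zcoeffLinear n f = zcoeff f n := rfl

theorem zcoeff_add (f g : Laurent) (n : ℤ) : zcoeff (f + g) n = zcoeff f n + zcoeff g n := rfl

theorem zcoeff_sub (f g : Laurent) (n : ℤ) : zcoeff (f - g) n = zcoeff f n - zcoeff g n := rfl

theorem zcoeff_smul (c : ℂ) (f : Laurent) (n : ℤ) : zcoeff (c • f) n = c * zcoeff f n := rfl

theorem zvar_ne_zero : zvar ≠ 0 := HahnSeries.single_ne_zero one_ne_zero

theorem zvar_zpow (k : ℤ) : zvar ^ k = HahnSeries.single (-k) (1 : ℂ) := by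
  rw [zvar, RatFunc.single_zpow, RatFunc.single_zpow (-k), zpow_neg_one, inv_zpow']

theorem zcoeff_zpow_mul (k : ℤ) (f : Laurent) (n : ℤ) :
    zcoeff (zvar ^ k * f) n = zcoeff f (n - k) := by
  rw [zvar_zpow, zcoeff, HahnSeries.coeff_single_mul, one_mul, zcoeff]
  congr 1
  ring

theorem zcoeff_pow_mul (k : ℕ) (f : Laurent) (n : ℤ) :
    zcoeff (zvar ^ k * f) n = zcoeff f (n - k) := by
  simpa using zcoeff_zpow_mul k f n

theorem zcoeff_pow (k : ℕ) (n : ℤ) : zcoeff (zvar ^ k) n = if n = k then 1 else 0 := by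
  rw [← zpow_natCast, zvar_zpow, zcoeff, HahnSeries.coeff_single]
  simp

theorem mul_mem_of_mem_span {S : Set Laurent} {W : Submodule ℂ Laurent} {f g : Laurent}
    (hS : ∀ s ∈ S, f * s ∈ W) (hg : g ∈ Submodule.span ℂ S) : f * g ∈ W := by
  induction hg using Submodule.span_induction with
  | mem s hs => exact hS s hs
  | zero => simp
  | add x y _ _ hx hy => simpa only [mul_add] using add_mem hx hy
  | smul c x _ hx => simpa only [mul_smul_comm] using W.smul_mem c hx

theorem HasOrder.unique {f : Laurent} {m n : ℤ} (hm : HasOrder f m) (hn : HasOrder f n) :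
    m = n := by
  obtain h | h | h := lt_trichotomy m n
  · exact absurd (hm.2 n h) hn.1
  · exact h
  · exact absurd (hn.2 m h) hm.1

theorem HasOrder.zpow_mul {f : Laurent} {n : ℤ} (hf : HasOrder f n) (k : ℤ) :
    HasOrder (zvar ^ k * f) (k + n) := by
  refine ⟨?_, fun m hm => ?_⟩
  · simpa only [zcoeff_zpow_mul, add_sub_cancel_left] using hf.1
  · rw [zcoeff_zpow_mul]
    exact hf.2 _ (by omega)

variable {ι : Type*} {e : ι → Laurent} {o : ι → ℤ}

theorem zcoeff_linearCombination (c : ι →₀ ℂ) (n : ℤ) :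
    zcoeff (Finsupp.linearCombination ℂ e c) n = ∑ i ∈ c.support, c i * zcoeff (e i) n := by
  rw [← zcoeffLinear_apply, Finsupp.linearCombination_apply, map_finsuppSum]
  rfl

theorem hasOrder_linearCombination (he : ∀ i, HasOrder (e i) (o i)) {c : ι →₀ ℂ} {i : ι}
    (hi : c i ≠ 0) (hmax : ∀ j, c j ≠ 0 → j ≠ i → o j < o i) :
    HasOrder (Finsupp.linearCombination ℂ e c) (o i) := by
  refine ⟨?_, fun m hm => ?_⟩
  · rw [zcoeff_linearCombination, Finset.sum_eq_single_of_mem i (Finsupp.mem_support_iff.mpr hi)]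
    · exact mul_ne_zero hi (he i).1
    · exact fun j hj hji => by
        rw [(he j).2 _ (hmax j (Finsupp.mem_support_iff.mp hj) hji), mul_zero]
  · rw [zcoeff_linearCombination]
    refine Finset.sum_eq_zero fun j hj => ?_
    obtain rfl | hji := eq_or_ne j i
    · rw [(he j).2 m hm, mul_zero]
    · rw [(he j).2 m ((hmax j (Finsupp.mem_support_iff.mp hj) hji).trans hm), mul_zero]

theorem setOf_hasOrder_span_range (ho : Function.Injective o) (he : ∀ i, HasOrder (e i) (o i)) :
    {n | ∃ f ∈ Submodule.span ℂ (Set.range e), HasOrder f n} = Set.range o := by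
  refine subset_antisymm ?_ ?_
  · rintro n ⟨f, hf, hn⟩
    obtain ⟨c, rfl⟩ := Finsupp.mem_span_range_iff_exists_finsupp.mp hf
    have hc : c ≠ 0 := by
      rintro rfl
      exact hn.1 (by simp [zcoeff])
    obtain ⟨i, hi, hmax⟩ := c.support.exists_max_image o (Finsupp.support_nonempty_iff.mpr hc)
    refine ⟨i, (hasOrder_linearCombination he (Finsupp.mem_support_iff.mp hi) ?_).unique hn⟩
    exact fun j hj hji =>
      (hmax j (Finsupp.mem_support_iff.mpr hj)).lt_of_ne fun h => hji (ho h)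
  · rintro _ ⟨i, rfl⟩
    exact ⟨e i, Submodule.subset_span ⟨i, rfl⟩, he i⟩

/-- A series in even powers of `z`. -/
def IsEven (f : Laurent) : Prop := ∀ n : ℤ, Odd n → zcoeff f n = 0

theorem IsEven.mul {f g : Laurent} (hf : IsEven f) (hg : IsEven g) : IsEven (f * g) := by
  intro n hn
  rw [zcoeff, HahnSeries.coeff_mul]
  refine Finset.sum_eq_zero fun ⟨a, b⟩ hab => ?_
  have hsum : a + b = -n := (Finset.mem_antidiagonal.mp hab).2.2
  obtain ha | ha := Int.even_or_odd a
  · have hb : Odd (-b) := by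
      rw [show -b = n + a by omega]
      exact hn.add_even ha
    rw [← neg_neg b, show HahnSeries.coeff g (- -b) = 0 from hg _ hb, mul_zero]
  · rw [← neg_neg a, show HahnSeries.coeff f (- -a) = 0 from hf _ ha.neg, zero_mul]

end LaurentSeries
/-! ### Canonical bases -/

section Canonical

theorem Idx.twoStepInduction {P : Idx → Prop} (three : P i3) (four : P i4)
    (plusTwo : ∀ j, P j → P j.plusTwo) (j : Idx) : P j := by
  obtain ⟨n, hn⟩ := j
  induction n using Nat.strong_induction_on with
  | _ n ih =>
    obtain rfl | rfl | hn5 : n = 3 ∨ n = 4 ∨ 5 ≤ n := by omega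
    · exact three
    · exact four
    · obtain ⟨m, rfl⟩ : ∃ m, n = m + 2 := ⟨n - 2, by omega⟩
      exact plusTwo ⟨m, by omega⟩ (ih m (by omega) (by omega))

/-- The series `z^(2i-6) p_3` and `z^(2i) p_4`, `i ≥ 0`. For a canonical family `p` they are a basis
of an element of the stratum `Σ₃`. -/
def stratumBasis (p : Idx → Laurent) : ℕ ⊕ ℕ → Laurent :=
  Sum.elim (fun i => zvar ^ (2 * i - 6 : ℤ) * p i3) fun i => zvar ^ (2 * i : ℤ) * p i4

/-- The orders of the series `stratumBasis p`. -/
def stratumOrder : ℕ ⊕ ℕ → ℤ :=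
  Sum.elim (fun i => 2 * i - 6 + 3) fun i => 2 * i + 4

theorem zvar_sq_mul_stratumBasis (p : Idx → Laurent) (x : ℕ ⊕ ℕ) :
    zvar ^ 2 * stratumBasis p x = stratumBasis p (x.map (· + 1) (· + 1)) := by
  have hsucc (k : ℤ) (f : Laurent) : zvar ^ 2 * (zvar ^ k * f) = zvar ^ (k + 2) * f := by
    rw [← mul_assoc, zpow_add₀ zvar_ne_zero, mul_comm (zvar ^ k), zpow_ofNat]
  obtain i | i := x
  · simp only [stratumBasis, Sum.elim_inl, Sum.map_inl, hsucc]
    congr 2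
    push_cast
    ring
  · simp only [stratumBasis, Sum.elim_inr, Sum.map_inr, hsucc]
    congr 2

theorem zSqStable_span_stratumBasis (p : Idx → Laurent) :
    ZSqStable (Submodule.span ℂ (Set.range (stratumBasis p))) := fun f hf => by
  refine mul_mem_of_mem_span ?_ hf
  rintro _ ⟨x, rfl⟩
  rw [zvar_sq_mul_stratumBasis]
  exact Submodule.subset_span ⟨_, rfl⟩

theorem injective_stratumOrder : Function.Injective stratumOrder := by
  rintro (i | i) (j | j) hij <;> simp only [stratumOrder, Sum.elim_inl, Sum.elim_inr] at hij
  · congr 1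
    omega
  · omega
  · omega
  · congr 1
    omega

theorem range_stratumOrder : Set.range stratumOrder = orderSet 3 := by
  ext n
  simp only [Set.mem_range, Sum.exists, stratumOrder, Sum.elim_inl, Sum.elim_inr, orderSet,
    Set.mem_ofPred_eq]
  constructor
  · rintro (⟨i, rfl⟩ | ⟨i, rfl⟩)
    · obtain hi | hi := le_or_gt i 3
      · exact .inr ⟨i, hi, by push_cast; ring⟩
      · exact .inl (by push_cast; omega)
    · exact .inl (by push_cast; omega)
  · intro h
    obtain ⟨k, hk⟩ | ⟨k, hk⟩ := Int.even_or_odd n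
    · exact .inr ⟨(k - 2).toNat, by omega⟩
    · exact .inl ⟨(k + 2).toNat, by omega⟩

namespace IsCanonical

variable {p : Idx → Laurent} (hp : IsCanonical p)

include hp

theorem hasOrder (j : Idx) : HasOrder (p j) j.1 := by
  have := j.2
  refine ⟨?_, fun n hn => ?_⟩
  · rw [hp j _ (by omega) (by omega), if_pos rfl]
    exact one_ne_zero
  · rw [hp j n (by omega) (by omega), if_neg hn.ne']

theorem hasOrder_stratumBasis (x : ℕ ⊕ ℕ) : HasOrder (stratumBasis p x) (stratumOrder x) :=
  match x with
  | .inl _ => (hp.hasOrder i3).zpow_mul _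
  | .inr _ => (hp.hasOrder i4).zpow_mul _

theorem zcoeff_one_eq_zero {f : Laurent} (hf : f ∈ Submodule.span ℂ (Set.range p)) :
    zcoeff f 1 = 0 := by
  suffices h : Submodule.span ℂ (Set.range p) ≤ LinearMap.ker (zcoeffLinear 1) from h hf
  rw [Submodule.span_le]
  rintro _ ⟨j, rfl⟩
  have := j.2
  exact (hp j 1 le_rfl (by norm_num)).trans (if_neg (by omega))

theorem zcoeff_linearCombination (c : Idx →₀ ℂ) (j : Idx) :
    zcoeff (Finsupp.linearCombination ℂ p c) j.1 = c j := by
  have := j.2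
  have hcoeff (i : Idx) : zcoeff (p i) j.1 = if i = j then 1 else 0 := by
    rw [hp i _ (by omega) (by omega)]
    simp [Subtype.ext_iff, eq_comm]
  simpa [SigmaThree.zcoeff_linearCombination, hcoeff] using Eq.symm

theorem linearIndependent : LinearIndependent ℂ p :=
  linearIndependent_iff.mpr fun c hc => Finsupp.ext fun j => by
    rw [← hp.zcoeff_linearCombination c j, hc]
    rfl

theorem eq_zero {f : Laurent} (hf : f ∈ Submodule.span ℂ (Set.range p))
    (h : ∀ n : ℤ, 3 ≤ n → zcoeff f n = 0) : f = 0 := by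
  obtain ⟨c, rfl⟩ := Finsupp.mem_span_range_iff_exists_finsupp.mp hf
  have hc : c = 0 := Finsupp.ext fun j =>
    (hp.zcoeff_linearCombination c j).symm.trans (h _ (by exact_mod_cast j.2))
  simp [hc]

variable (hz : ZSqStable (Submodule.span ℂ (Set.range p)))

include hz

theorem zvar_sq_mul (j : Idx) : zvar ^ 2 * p j = p j.plusTwo + zcoeff (p j) 2 • p i4 := by
  have hmem (k : Idx) : p k ∈ Submodule.span ℂ (Set.range p) := Submodule.subset_span ⟨k, rfl⟩
  refine sub_eq_zero.mp (hp.eq_zero (sub_mem (hz _ (hmem j))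
    (add_mem (hmem _) (Submodule.smul_mem _ _ (hmem _)))) fun n hn => ?_)
  have := j.2
  rw [zcoeff_sub, zcoeff_add, zcoeff_smul, zcoeff_pow_mul, hp _ n (by omega) (by omega),
    hp _ n (by omega) (by omega)]
  rw [show (j.plusTwo.1 : ℤ) = j.1 + 2 by simp [Idx.plusTwo], show (i4.1 : ℤ) = 4 from rfl,
    Nat.cast_ofNat]
  obtain rfl | h4 := eq_or_ne n 4
  · rw [if_neg (by omega)]
    norm_num
  · rw [hp j (n - 2) (by omega) (by omega), if_neg h4]
    simp [sub_eq_iff_eq_add]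

theorem exists_stratum : ∃ V ∈ stratum 3, Submodule.span ℂ (Set.range p) ≤ V := by
  have hstable := zSqStable_span_stratumBasis p
  refine ⟨_, ⟨hstable, (setOf_hasOrder_span_range injective_stratumOrder
    hp.hasOrder_stratumBasis).trans range_stratumOrder⟩, ?_⟩
  have hmem (x : ℕ ⊕ ℕ) : stratumBasis p x ∈ Submodule.span ℂ (Set.range (stratumBasis p)) :=
    Submodule.subset_span ⟨x, rfl⟩
  have hfour : p i4 ∈ Submodule.span ℂ (Set.range (stratumBasis p)) := by
    simpa [stratumBasis] using hmem (.inr 0)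
  rw [Submodule.span_le]
  rintro _ ⟨j, rfl⟩
  induction j using Idx.twoStepInduction with
  | three => simpa [stratumBasis] using hmem (.inl 3)
  | four => exact hfour
  | plusTwo j hj =>
    rw [eq_sub_of_add_eq (hp.zvar_sq_mul hz j).symm]
    exact sub_mem (hstable _ hj) (Submodule.smul_mem _ _ hfour)

theorem zcoeff_eq_zero_of_odd_of_le_one {f : Laurent}
    (hf : f ∈ Submodule.span ℂ (Set.range p)) {n : ℤ} (hn : Odd n) (hn1 : n ≤ 1) :
    zcoeff f n = 0 := by
  obtain ⟨m, rfl⟩ : ∃ m : ℕ, n = 1 - 2 * m := by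
    obtain ⟨k, rfl⟩ := hn
    exact ⟨(-k).toNat, by omega⟩
  clear hn hn1
  induction m generalizing f with
  | zero => simpa using hp.zcoeff_one_eq_zero hf
  | succ m ih =>
    have h := ih (hz f hf)
    rw [zcoeff_pow_mul] at h
    rw [← h]
    push_cast
    ring_nf

theorem isEven_sub_pow (j : Idx) : IsEven (p j - zvar ^ j.1) := by
  intro n hn
  rw [zcoeff_sub, zcoeff_pow]
  have := j.2
  obtain hn1 | hn1 := le_or_gt n 1
  · rw [hp.zcoeff_eq_zero_of_odd_of_le_one hz (Submodule.subset_span ⟨j, rfl⟩) hn hn1,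
      if_neg (by omega), sub_zero]
  · rw [hp j n hn1.le (by rintro rfl; exact absurd hn (by decide)), sub_self]

theorem isEven_i4 : IsEven (p i4) := fun n hn => by
  have h := hp.isEven_sub_pow hz i4 n hn
  rwa [zcoeff_sub, zcoeff_pow, if_neg, sub_zero] at h
  rintro rfl
  exact absurd hn (by decide)

variable (hm : ∀ f ∈ Submodule.span ℂ (Set.range p), ∀ g ∈ Submodule.span ℂ (Set.range p),
  f * g ∈ Submodule.span ℂ (Set.range p))

include hm

/-- As `p₃ - z³` and `p₄` are even, the odd part of `p₃ p₄` is `z³ p₄`. -/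
theorem zcoeff_i4_eq_zero_of_neg {n : ℤ} (hn : n < 0) : zcoeff (p i4) n = 0 := by
  obtain hn2 | hn2 := Int.even_or_odd n
  · have hodd : Odd (n + 3) := hn2.add_odd (by decide)
    have hmul : p i3 * p i4 = zvar ^ 3 * p i4 + (p i3 - zvar ^ 3) * p i4 := by ring
    have h := hp.zcoeff_eq_zero_of_odd_of_le_one hz
      (hm _ (Submodule.subset_span ⟨i3, rfl⟩) _ (Submodule.subset_span ⟨i4, rfl⟩)) hodd
      (by obtain ⟨k, rfl⟩ := hn2; omega)
    have heven : IsEven (p i3 - zvar ^ 3) := hp.isEven_sub_pow hz i3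
    rw [hmul, zcoeff_add, zcoeff_pow_mul, heven.mul (hp.isEven_i4 hz) _ hodd] at h
    simpa using h
  · exact hp.isEven_i4 hz n hn2

/-- As `p₃ - z³` is even, the odd part of `p₃² = 2 z³ p₃ - z⁶ + (p₃ - z³)²` at negative powers is
that of `2 z³ p₃`. -/
theorem zcoeff_i3_eq_zero_of_neg {n : ℤ} (hn : n < 0) : zcoeff (p i3) n = 0 := by
  have hmem : p i3 ∈ Submodule.span ℂ (Set.range p) := Submodule.subset_span ⟨i3, rfl⟩
  obtain hn2 | hn2 := Int.even_or_odd n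
  · have hodd : Odd (n + 3) := hn2.add_odd (by decide)
    have hn1 : n + 3 ≤ 1 := by obtain ⟨k, rfl⟩ := hn2; omega
    have hsq : p i3 * p i3 = zvar ^ 3 * p i3 + zvar ^ 3 * p i3 - zvar ^ 6
        + (p i3 - zvar ^ 3) * (p i3 - zvar ^ 3) := by ring
    have h := hp.zcoeff_eq_zero_of_odd_of_le_one hz (hm _ hmem _ hmem) hodd hn1
    have heven : IsEven (p i3 - zvar ^ 3) := hp.isEven_sub_pow hz i3
    rw [hsq, zcoeff_add, zcoeff_sub, zcoeff_add, zcoeff_pow_mul, zcoeff_pow, if_neg (by omega),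
      heven.mul heven _ hodd] at h
    simpa using h
  · exact hp.zcoeff_eq_zero_of_odd_of_le_one hz hmem hn2 (by omega)

theorem zcoeff_eq_zero_of_neg (j : Idx) {n : ℤ} (hn : n < 0) : zcoeff (p j) n = 0 := by
  induction j using Idx.twoStepInduction generalizing n with
  | three => exact hp.zcoeff_i3_eq_zero_of_neg hz hm hn
  | four => exact hp.zcoeff_i4_eq_zero_of_neg hz hm hn
  | plusTwo j ih =>
    rw [eq_sub_of_add_eq (hp.zvar_sq_mul hz j).symm, zcoeff_sub, zcoeff_smul, zcoeff_pow_mul,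
      hp.zcoeff_i4_eq_zero_of_neg hz hm hn, ih (by push_cast; omega), mul_zero, sub_zero]

end IsCanonical

end Canonical

section Polynomials

/-- The embedding of `ℂ[z]` into the Laurent series in `1/z`. -/
def toLaurent : ℂ[X] →+* Laurent := eval₂RingHom HahnSeries.C zvar

theorem toLaurent_C_mul (c : ℂ) (P : ℂ[X]) : toLaurent (C c * P) = c • toLaurent P := by
  rw [map_mul, ← HahnSeries.C_mul_eq_smul, toLaurent, coe_eval₂RingHom, eval₂_C]

theorem toLaurent_X_pow (n : ℕ) : toLaurent (X ^ n) = zvar ^ n := by simp [toLaurent]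

theorem toLaurent_smul (c : ℂ) (P : ℂ[X]) : toLaurent (c • P) = c • toLaurent P := by
  rw [smul_eq_C_mul, toLaurent_C_mul]

theorem toLaurent_linearCombination {ι : Type*} (P : ι → ℂ[X]) (c : ι →₀ ℂ) :
    toLaurent (Finsupp.linearCombination ℂ P c)
      = Finsupp.linearCombination ℂ (fun i => toLaurent (P i)) c := by
  simp only [Finsupp.linearCombination_apply, map_finsuppSum, toLaurent_smul]

theorem zcoeff_toLaurent_monomial (k : ℕ) (a : ℂ) (n : ℤ) :
    zcoeff (toLaurent (monomial k a)) n = if n = k then a else 0 := by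
  rw [← C_mul_X_pow_eq_monomial, toLaurent_C_mul, toLaurent_X_pow, zcoeff_smul, zcoeff_pow,
    mul_ite, mul_one, mul_zero]

theorem zcoeff_toLaurent_natCast (P : ℂ[X]) (n : ℕ) : zcoeff (toLaurent P) n = P.coeff n := by
  induction P using Polynomial.induction_on' with
  | add P Q hP hQ => rw [map_add, zcoeff_add, hP, hQ, coeff_add]
  | monomial k a => simp [zcoeff_toLaurent_monomial, coeff_monomial, eq_comm]

theorem zcoeff_toLaurent_of_neg (P : ℂ[X]) {n : ℤ} (hn : n < 0) : zcoeff (toLaurent P) n = 0 := by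
  induction P using Polynomial.induction_on' with
  | add P Q hP hQ => rw [map_add, zcoeff_add, hP, hQ, add_zero]
  | monomial k a => rw [zcoeff_toLaurent_monomial, if_neg (by omega)]

theorem toLaurent_injective : Function.Injective toLaurent := fun P Q h => by
  ext n
  rw [← zcoeff_toLaurent_natCast, ← zcoeff_toLaurent_natCast, h]

end Polynomials

/-! ### The family of spaces `Params.space` -/

namespace Params

variable (h : Params)

section SpaceOfParams

theorem toLaurent_poly (j : Idx) : toLaurent (h.poly j) = h.series j := by
  rw [poly, series, map_add, map_add, toLaurent_C_mul, toLaurent_X_pow, toLaurent_X_pow,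
    ← mul_one (C (h.v j)), toLaurent_C_mul, map_one]

theorem coeff_poly {j : Idx} {n : ℕ} (hn : 1 ≤ n) (h2 : n ≠ 2) :
    (h.poly j).coeff n = if n = j.1 then 1 else 0 := by
  simp [poly, coeff_X_pow, coeff_C, h2, Nat.one_le_iff_ne_zero.mp hn]

theorem coeff_poly_two (j : Idx) : (h.poly j).coeff 2 = h.u j := by
  have hj : 2 ≠ j.1 := by have := j.2; omega
  simp [poly, coeff_X_pow, hj]

theorem coeff_poly_zero (j : Idx) : (h.poly j).coeff 0 = h.v j := by
  have hj : 0 ≠ j.1 := by have := j.2; omega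
  simp [poly, coeff_X_pow, hj]

theorem isCanonical_series : IsCanonical h.series := fun j n hn h2 => by
  lift n to ℕ using by omega
  rw [← toLaurent_poly, zcoeff_toLaurent_natCast, coeff_poly h (by omega) (by omega)]
  simp

theorem zcoeff_series_two (j : Idx) : zcoeff (h.series j) 2 = h.u j := by
  simpa [toLaurent_poly, coeff_poly_two] using zcoeff_toLaurent_natCast (h.poly j) 2

theorem zcoeff_series_zero (j : Idx) : zcoeff (h.series j) 0 = h.v j := by
  simpa [toLaurent_poly, coeff_poly_zero] using zcoeff_toLaurent_natCast (h.poly j) 0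

theorem series_mem_space (j : Idx) : h.series j ∈ h.space := Submodule.subset_span ⟨j, rfl⟩

theorem space_injective : Function.Injective space := by
  intro h k hhk
  have hs : h.series = k.series := funext fun j => by
    have hmem : h.series j ∈ k.space := hhk ▸ h.series_mem_space j
    refine sub_eq_zero.mp (k.isCanonical_series.eq_zero
      (sub_mem hmem (k.series_mem_space j)) fun n hn => ?_)
    rw [zcoeff_sub, h.isCanonical_series j n (by omega) (by omega),
      k.isCanonical_series j n (by omega) (by omega), sub_self]
  ext j
  · rw [← zcoeff_series_two, hs, zcoeff_series_two]
  · rw [← zcoeff_series_zero, hs, zcoeff_series_zero]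

theorem toLaurent_mem_space_iff {α β : ℂ} :
    toLaurent (C α * X ^ 2 + C β) ∈ h.space ↔ α = 0 ∧ β = 0 := by
  refine ⟨fun hmem => ?_, fun ⟨hα, hβ⟩ => by simp [hα, hβ]⟩
  have hzero : C α * X ^ 2 + C β = 0 := by
    refine toLaurent_injective ((h.isCanonical_series.eq_zero hmem fun n hn => ?_).trans
      (map_zero toLaurent).symm)
    lift n to ℕ using by omega
    rw [zcoeff_toLaurent_natCast, coeff_add, coeff_C_mul, coeff_X_pow, coeff_C,
      if_neg (by omega), if_neg (by omega), mul_zero, add_zero]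
  exact ⟨by simpa using congrArg (coeff · 2) hzero, by simpa using congrArg (coeff · 0) hzero⟩

end SpaceOfParams

section Multiplication

theorem X_sq_mul_poly (j : Idx) :
    X ^ 2 * h.poly j = h.poly j.plusTwo + C (h.u j) * h.poly i4
      - (C (h.u j.plusTwo + h.u j * h.u i4 - h.v j) * X ^ 2
        + C (h.v j.plusTwo + h.u j * h.v i4)) := by
  simp only [poly, Idx.plusTwo, i4, map_add, map_sub, map_mul]
  ring

theorem zvar_sq_mul_series_mem_space_iff (j : Idx) : zvar ^ 2 * h.series j ∈ h.space ↔
    h.u j.plusTwo + h.u j * h.u i4 - h.v j = 0 ∧ h.v j.plusTwo + h.u j * h.v i4 = 0 := by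
  rw [← h.toLaurent_mem_space_iff, ← toLaurent_X_pow, ← toLaurent_poly, ← map_mul, X_sq_mul_poly,
    map_sub, map_add, toLaurent_C_mul, toLaurent_poly, toLaurent_poly]
  exact h.space.sub_mem_iff_right (add_mem (h.series_mem_space _)
    (Submodule.smul_mem _ _ (h.series_mem_space _)))

/-- The coefficient of `z²` in `∑ C_{jk}^l p_l - p_j p_k`. -/
def defectU (j k : Idx) : ℂ :=
  h.u (j.plus k) + h.u k * h.u j.plusTwo + h.u j * h.u k.plusTwo + h.u j * h.u k * h.u i4

/-- The constant coefficient of `∑ C_{jk}^l p_l - p_j p_k`. -/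
def defectV (j k : Idx) : ℂ :=
  h.v (j.plus k) + h.u k * h.v j.plusTwo + h.u j * h.v k.plusTwo + h.v j * h.v k
    + h.u j * h.u k * h.v i4

theorem linearCombination_structConst {M : Type*} [AddCommGroup M] [Module ℂ M] (w : Idx → M)
    (j k : Idx) : Finsupp.linearCombination ℂ w (h.structConst j k)
      = w (j.plus k) + h.u k • w j.plusTwo + h.v k • w j + h.u j • w k.plusTwo + h.v j • w k
        + (h.u j * h.u k) • w i4 := by
  simp only [structConst, map_add, Finsupp.linearCombination_single, one_smul]

theorem poly_mul_poly (j k : Idx) : h.poly j * h.poly k =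
    Finsupp.linearCombination ℂ h.poly (h.structConst j k)
      - (C (h.defectU j k) * X ^ 2 + C (h.defectV j k)) := by
  simp only [linearCombination_structConst, poly, defectU, defectV, Idx.plus, Idx.plusTwo, i4,
    smul_eq_C_mul, map_add, map_mul]
  ring

theorem series_mul_series_eq_sub (j k : Idx) : h.series j * h.series k =
    Finsupp.linearCombination ℂ h.series (h.structConst j k)
      - toLaurent (C (h.defectU j k) * X ^ 2 + C (h.defectV j k)) := by
  rw [← toLaurent_poly, ← toLaurent_poly, ← map_mul, poly_mul_poly, map_sub,
    toLaurent_linearCombination, funext h.toLaurent_poly]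

theorem series_mul_series_mem_space_iff (j k : Idx) :
    h.series j * h.series k ∈ h.space ↔ h.defectU j k = 0 ∧ h.defectV j k = 0 := by
  rw [← h.toLaurent_mem_space_iff, series_mul_series_eq_sub]
  exact h.space.sub_mem_iff_right (Finsupp.mem_span_range_iff_exists_finsupp.mpr ⟨_, rfl⟩)

theorem defectU_comm (j k : Idx) : h.defectU j k = h.defectU k j := by
  rw [defectU, defectU, Subtype.ext (Nat.add_comm j.1 k.1) (a1 := j.plus k) (a2 := k.plus j)]
  ring

theorem defectV_comm (j k : Idx) : h.defectV j k = h.defectV k j := by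
  rw [defectV, defectV, Subtype.ext (Nat.add_comm j.1 k.1) (a1 := j.plus k) (a2 := k.plus j)]
  ring

end Multiplication

section Constraints

variable {h}

theorem zSqStable_space_iff : ZSqStable h.space ↔ ∀ j : Idx,
    h.u j.plusTwo + h.u j * h.u i4 - h.v j = 0 ∧ h.v j.plusTwo + h.u j * h.v i4 = 0 := by
  simp only [← zvar_sq_mul_series_mem_space_iff]
  refine ⟨fun hz j => hz _ (h.series_mem_space j), fun hz f hf => mul_mem_of_mem_span ?_ hf⟩
  rintro _ ⟨j, rfl⟩
  exact hz j

theorem mul_mem_space_iff : (∀ f ∈ h.space, ∀ g ∈ h.space, f * g ∈ h.space) ↔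
    ∀ j k : Idx, h.defectU j k = 0 ∧ h.defectV j k = 0 := by
  simp only [← series_mul_series_mem_space_iff]
  refine ⟨fun hm j k => hm _ (h.series_mem_space j) _ (h.series_mem_space k),
    fun hm f hf g hg => mul_mem_of_mem_span ?_ hg⟩
  rintro _ ⟨k, rfl⟩
  rw [mul_comm]
  refine mul_mem_of_mem_span ?_ hf
  rintro _ ⟨j, rfl⟩
  exact hm k j

section ZSqStable

variable (hz : ZSqStable h.space)

include hz

theorem u_plusTwo (j : Idx) : h.u j.plusTwo = h.v j - h.u j * h.u i4 := by
  linear_combination (zSqStable_space_iff.mp hz j).1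

theorem v_plusTwo (j : Idx) : h.v j.plusTwo = -(h.u j * h.v i4) := by
  linear_combination (zSqStable_space_iff.mp hz j).2

theorem defectU_plusTwo (j k : Idx) :
    h.defectU j.plusTwo k = h.defectV j k - h.u i4 * h.defectU j k := by
  have hjk : j.plusTwo.plus k = (j.plus k).plusTwo := Subtype.ext (Nat.add_right_comm ..)
  simp only [defectU, defectV, hjk, u_plusTwo hz, v_plusTwo hz]
  ring

theorem defectV_plusTwo (j k : Idx) : h.defectV j.plusTwo k = -(h.v i4 * h.defectU j k) := by
  have hjk : j.plusTwo.plus k = (j.plus k).plusTwo := Subtype.ext (Nat.add_right_comm ..)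
  simp only [defectU, defectV, hjk, u_plusTwo hz, v_plusTwo hz]
  ring

theorem defectU_i3_i3 : h.defectU i3 i3 =
    h.v i4 + 2 * h.v i3 * h.u i3 - h.u i3 ^ 2 * h.u i4 - h.u i4 ^ 2 := by
  simp only [defectU, show i3.plus i3 = i4.plusTwo from rfl, u_plusTwo hz]
  ring

theorem defectV_i3_i3 : h.defectV i3 i3 =
    h.v i3 ^ 2 - h.u i3 ^ 2 * h.v i4 - h.u i4 * h.v i4 := by
  simp only [defectV, show i3.plus i3 = i4.plusTwo from rfl, v_plusTwo hz]
  ring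

theorem defect_i3_i4 : h.defectU i3 i4 = 0 ∧ h.defectV i3 i4 = 0 := by
  simp only [defectU, defectV, show i3.plus i4 = i3.plusTwo.plusTwo from rfl, u_plusTwo hz,
    v_plusTwo hz]
  constructor <;> ring

theorem defect_i4_i4 : h.defectU i4 i4 = 0 ∧ h.defectV i4 i4 = 0 := by
  simp only [defectU, defectV, show i4.plus i4 = i4.plusTwo.plusTwo from rfl, u_plusTwo hz,
    v_plusTwo hz]
  constructor <;> ring

theorem defect_eq_zero_of_i3_i4 {k : Idx} (h3 : h.defectU i3 k = 0 ∧ h.defectV i3 k = 0)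
    (h4 : h.defectU i4 k = 0 ∧ h.defectV i4 k = 0) (j : Idx) :
    h.defectU j k = 0 ∧ h.defectV j k = 0 := by
  induction j using Idx.twoStepInduction with
  | three => exact h3
  | four => exact h4
  | plusTwo j ih => simp [defectU_plusTwo hz, defectV_plusTwo hz, ih.1, ih.2]

theorem defect_eq_zero (h33 : h.defectU i3 i3 = 0 ∧ h.defectV i3 i3 = 0) (j k : Idx) :
    h.defectU j k = 0 ∧ h.defectV j k = 0 := by
  have h43 : h.defectU i4 i3 = 0 ∧ h.defectV i4 i3 = 0 := by
    simpa only [defectU_comm, defectV_comm] using defect_i3_i4 hz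
  refine defect_eq_zero_of_i3_i4 hz ?_ ?_ j
  · rw [defectU_comm, defectV_comm]
    exact defect_eq_zero_of_i3_i4 hz h33 h43 k
  · rw [defectU_comm, defectV_comm]
    exact defect_eq_zero_of_i3_i4 hz (defect_i3_i4 hz) (defect_i4_i4 hz) k

end ZSqStable

/-- Along a `z²`-stable space all defects are determined by those of `p₃²`, which are the left-hand
sides of the two nonlinear equations. -/
theorem constraints_iff_space_mem_W3 : h.Constraints ↔ h.space ∈ W3 := by
  have hcan : ∃ p, IsCanonical p ∧ h.space = Submodule.span ℂ (Set.range p) :=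
    ⟨h.series, h.isCanonical_series, rfl⟩
  constructor
  · rintro ⟨hrec, hu, hv⟩
    have hz := zSqStable_space_iff.mpr hrec
    exact ⟨hcan, hz, mul_mem_space_iff.mpr
      (defect_eq_zero hz ⟨(defectU_i3_i3 hz).trans hu, (defectV_i3_i3 hz).trans hv⟩)⟩
  · rintro ⟨-, hz, hm⟩
    have h33 := mul_mem_space_iff.mp hm i3 i3
    rw [defectU_i3_i3 hz, defectV_i3_i3 hz] at h33
    exact ⟨zSqStable_space_iff.mp hz, h33⟩

end Constraints

end Params

section Classification

theorem exists_stratum_of_mem_W3 {W : Submodule ℂ Laurent} (hW : W ∈ W3) :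
    ∃ V ∈ stratum 3, W ≤ V := by
  obtain ⟨⟨p, hp, rfl⟩, hz, -⟩ := hW
  exact hp.exists_stratum hz

/-- The coefficients at `z²` and `z⁰` of the members of a family of Laurent series. -/
def Params.ofFamily (p : Idx → Laurent) : Params :=
  ⟨fun j => zcoeff (p j) 2, fun j => zcoeff (p j) 0⟩

theorem IsCanonical.series_ofFamily {p : Idx → Laurent} (hp : IsCanonical p)
    (hneg : ∀ j n, n < 0 → zcoeff (p j) n = 0) : (Params.ofFamily p).series = p := by
  funext j
  refine laurent_ext fun n => ?_
  obtain hn | rfl | hn : n < 0 ∨ n = 0 ∨ 1 ≤ n := by omega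
  · rw [← Params.toLaurent_poly, zcoeff_toLaurent_of_neg _ hn, hneg j n hn]
  · exact Params.zcoeff_series_zero _ j
  · obtain rfl | hn2 := eq_or_ne n 2
    · exact Params.zcoeff_series_two _ j
    · rw [Params.isCanonical_series _ j n hn hn2, hp j n hn hn2]

theorem bijOn_space : Set.BijOn Params.space {h | h.Constraints} W3 := by
  refine ⟨fun h hc => Params.constraints_iff_space_mem_W3.mp hc,
    Params.space_injective.injOn, fun W hW => ?_⟩
  obtain ⟨⟨p, hp, rfl⟩, hz, hm⟩ := id hW
  have hspace : (Params.ofFamily p).space = Submodule.span ℂ (Set.range p) := by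
    rw [Params.space, hp.series_ofFamily fun j n hn => hp.zcoeff_eq_zero_of_neg hz hm j hn]
  exact ⟨_, Params.constraints_iff_space_mem_W3.mpr (hspace ▸ hW), hspace⟩

end Classification

section CountingSolutions

/-- The solution of the linear recursion for `(H^j_{-2}, H^j_0)`, at `j = i + 3`, with initial
values `(a, b)` at `j = 3` and `(c, d)` at `j = 4`. -/
def recSeq (a b c d : ℂ) : ℕ → ℂ × ℂ
  | 0 => (a, b)
  | 1 => (c, d)
  | i + 2 => ((recSeq a b c d i).2 - (recSeq a b c d i).1 * c, -((recSeq a b c d i).1 * d))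

/-- The solution of the linear recursion with given `H^3_{-2}, H^3_0, H^4_{-2}, H^4_0`. -/
def Params.ofInitial (a b c d : ℂ) : Params where
  u j := (recSeq a b c d (j.1 - 3)).1
  v j := (recSeq a b c d (j.1 - 3)).2

theorem recSeq_plusTwo (a b c d : ℂ) (j : Idx) : recSeq a b c d (j.plusTwo.1 - 3) =
    ((recSeq a b c d (j.1 - 3)).2 - (recSeq a b c d (j.1 - 3)).1 * c,
      -((recSeq a b c d (j.1 - 3)).1 * d)) := by
  have := j.2
  rw [show j.plusTwo.1 - 3 = j.1 - 3 + 2 by simp only [Idx.plusTwo]; omega, recSeq]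

theorem Params.Constraints.eq_ofInitial {h : Params} (hc : h.Constraints) :
    h = ofInitial (h.u i3) (h.v i3) (h.u i4) (h.v i4) := by
  have hrec (j : Idx) :
      recSeq (h.u i3) (h.v i3) (h.u i4) (h.v i4) (j.1 - 3) = (h.u j, h.v j) := by
    have hz := zSqStable_space_iff.mpr hc.1
    induction j using Idx.twoStepInduction with
    | three => rfl
    | four => rfl
    | plusTwo j ih => rw [recSeq_plusTwo, ih, u_plusTwo hz, v_plusTwo hz]
  ext j
  · exact (congrArg Prod.fst (hrec j)).symm
  · exact (congrArg Prod.snd (hrec j)).symm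

theorem Params.constraints_ofInitial_iff {a b c d : ℂ} : (ofInitial a b c d).Constraints ↔
    d + 2 * b * a - a ^ 2 * c - c ^ 2 = 0 ∧ b ^ 2 - a ^ 2 * d - c * d = 0 := by
  refine and_iff_right fun j => ?_
  simp only [ofInitial, recSeq_plusTwo]
  exact ⟨by simp [i4, recSeq], by simp [i4, recSeq]⟩

/-- The first nonlinear equation expresses `H^4_0` through the other initial values; the second one
then becomes a monic quadratic equation for `H^3_0`. -/
theorem ncard_constraints (α γ : ℂ) :
    {h : Params | h.Constraints ∧ h.u i3 = α ∧ h.u i4 = γ}.ncard = 1 ∨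
      {h : Params | h.Constraints ∧ h.u i3 = α ∧ h.u i4 = γ}.ncard = 2 := by
  let f (b : ℂ) : Params := .ofInitial α b γ (α ^ 2 * γ + γ ^ 2 - 2 * b * α)
  have hf : Function.Injective f := fun b b' hbb => congrArg (fun h : Params => h.v i3) hbb
  have hfc (b : ℂ) : (f b).Constraints ↔
      b ^ 2 + 2 * α * (α ^ 2 + γ) * b + -(γ * (α ^ 2 + γ) ^ 2) = 0 := by
    rw [Params.constraints_ofInitial_iff]
    exact ⟨fun hb => by linear_combination hb.2, fun hb => ⟨by ring, by linear_combination hb⟩⟩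
  have himage : {h : Params | h.Constraints ∧ h.u i3 = α ∧ h.u i4 = γ}
      = f '' {b | b ^ 2 + 2 * α * (α ^ 2 + γ) * b + -(γ * (α ^ 2 + γ) ^ 2) = 0} := by
    simp only [← hfc]
    ext h
    constructor
    · rintro ⟨hc, rfl, rfl⟩
      have hd : h.v i4 = h.u i3 ^ 2 * h.u i4 + h.u i4 ^ 2 - 2 * h.v i3 * h.u i3 := by
        linear_combination hc.2.1
      have hfh : f (h.v i3) = h := by
        simp only [f, ← hd]
        exact hc.eq_ofInitial.symm
      exact ⟨h.v i3, hfh.symm ▸ hc, hfh⟩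
    · rintro ⟨b, hb, rfl⟩
      exact ⟨hb, rfl, rfl⟩
  rw [himage, Set.ncard_image_of_injective _ hf]
  exact ncard_setOf_sq_add_mul_add_eq_zero _ _

end CountingSolutions

/-! ### The algebra spanned by the `p_j` and the ideal of relations -/

namespace Params

section Algebra

variable (h : Params)

theorem linearIndependent_series : LinearIndependent ℂ h.series :=
  h.isCanonical_series.linearIndependent

theorem not_finite_space : ¬ Module.Finite ℂ h.space := by
  intro hfin
  rw [space] at hfin
  have hIdx : Infinite Idx := Set.infinite_coe_iff.mpr (Set.Ici_infinite 3)
  exact hIdx.not_finite (Module.Finite.finite_basis (.span h.linearIndependent_series))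

theorem structConst_comm (j k : Idx) : h.structConst j k = h.structConst k j := by
  rw [structConst, structConst, show j.plus k = k.plus j from Subtype.ext (Nat.add_comm ..),
    mul_comm (h.u j)]
  abel

theorem quadric_eq_sub_linearCombination (j k : Idx) : h.quadric j k =
    MvPolynomial.X j * MvPolynomial.X k
      - Finsupp.linearCombination ℂ MvPolynomial.X (h.structConst j k) := by
  simp only [quadric, Finsupp.linearCombination_apply, MvPolynomial.smul_eq_C_mul]

theorem natDegree_poly_le (j : Idx) : (h.poly j).natDegree ≤ j.1 := by
  have := j.2
  rw [poly]
  compute_degree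
  omega

theorem coeff_poly_self (j : Idx) : (h.poly j).coeff j.1 = 1 := by
  have := j.2
  rw [coeff_poly h (by omega) (by omega), if_pos rfl]

theorem natDegree_poly (j : Idx) : (h.poly j).natDegree = j.1 :=
  natDegree_eq_of_le_of_coeff_ne_zero (h.natDegree_poly_le j)
    (h.coeff_poly_self j ▸ one_ne_zero)

theorem monic_poly (j : Idx) : (h.poly j).Monic :=
  monic_of_natDegree_le_of_coeff_eq_one j.1 (h.natDegree_poly_le j) (h.coeff_poly_self j)

theorem linearIndependent_one_poly :
    LinearIndependent ℂ fun o : Option Idx => o.elim 1 h.poly := by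
  have hdeg (o : Option Idx) : (o.elim 1 h.poly).natDegree = o.elim 0 Subtype.val := by
    cases o with
    | none => exact natDegree_one
    | some j => exact h.natDegree_poly j
  refine linearIndependent_of_natDegree_injective (fun o => ?_) fun o o' hoo => ?_
  · cases o with
    | none => exact one_ne_zero
    | some j => exact (h.monic_poly j).ne_zero
  · simp only [hdeg] at hoo
    obtain - | ⟨j, hj⟩ := o <;> obtain - | ⟨j', hj'⟩ := o' <;> simp only [Option.elim] at hoo
    · rfl
    · omega
    · omega
    · exact congrArg some (Subtype.ext hoo)

end Algebra

namespace Constraints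

variable {h : Params} (hc : h.Constraints)

include hc

theorem poly_mul_poly (j k : Idx) :
    h.poly j * h.poly k = Finsupp.linearCombination ℂ h.poly (h.structConst j k) := by
  obtain ⟨-, -, hm⟩ := constraints_iff_space_mem_W3.mp hc
  obtain ⟨hu, hv⟩ := mul_mem_space_iff.mp hm j k
  rw [Params.poly_mul_poly, hu, hv, map_zero, zero_mul, add_zero, sub_zero]

theorem series_mul_series (j k : Idx) :
    h.series j * h.series k = (h.structConst j k).sum fun l c => c • h.series l := by
  rw [← toLaurent_poly, ← toLaurent_poly, ← map_mul, hc.poly_mul_poly,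
    toLaurent_linearCombination, Finsupp.linearCombination_apply]
  simp only [toLaurent_poly]

theorem structConst_assoc (i j k : Idx) :
    ((h.structConst i j).sum fun s c => c • h.structConst s k) =
      (h.structConst j k).sum fun s c => c • h.structConst i s := by
  have hmul (j k : Idx) : Finsupp.linearCombination ℂ h.series (h.structConst j k)
      = h.series j * h.series k := (hc.series_mul_series j k).symm
  refine h.linearIndependent_series ?_
  simp only [map_finsuppSum, map_smul, hmul]
  calc (h.structConst i j).sum (fun s c => c • (h.series s * h.series k))
      = h.series i * h.series j * h.series k := by
        rw [hc.series_mul_series, Finsupp.sum_mul]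
        simp only [smul_mul_assoc]
    _ = h.series i * (h.series j * h.series k) := mul_assoc ..
    _ = (h.structConst j k).sum fun s c => c • (h.series i * h.series s) := by
        rw [hc.series_mul_series j k, Finsupp.mul_sum]
        simp only [mul_smul_comm]

theorem aeval_quadric (j k : Idx) : MvPolynomial.aeval h.poly (h.quadric j k) = 0 := by
  rw [quadric_eq_sub_linearCombination, map_sub, map_mul, MvPolynomial.aeval_X,
    MvPolynomial.aeval_X, hc.poly_mul_poly, ← AlgHom.toLinearMap_apply,
    Finsupp.apply_linearCombination, sub_eq_zero]
  congr 2
  funext l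
  simp

/-- Modulo the quadrics every polynomial is a linear combination of `1` and the variables, and the
`p_j(z)` are linearly independent together with `1`. -/
theorem quadricIdeal_eq_ker : h.quadricIdeal = RingHom.ker (MvPolynomial.aeval h.poly :
    MvPolynomial Idx ℂ →ₐ[ℂ] ℂ[X]) := by
  refine eq_ker_aeval_of_quadratic ?_ (fun j k => ?_) h.linearIndependent_one_poly
  · rw [quadricIdeal, Ideal.span_le]
    rintro _ ⟨j, k, rfl⟩
    exact hc.aeval_quadric j k
  · rw [← sub_add_cancel (MvPolynomial.X j * MvPolynomial.X k)
      (Finsupp.linearCombination ℂ MvPolynomial.X (h.structConst j k)),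
      ← quadric_eq_sub_linearCombination]
    refine Submodule.add_mem_sup (Ideal.subset_span ⟨j, k, rfl⟩) ?_
    refine Submodule.span_mono ?_ (Finsupp.mem_span_range_iff_exists_finsupp.mpr ⟨_, rfl⟩)
    rintro _ ⟨l, rfl⟩
    exact ⟨some l, rfl⟩

theorem eval_quadric_eq_zero_iff {x : Idx → ℂ} :
    (∀ j k, MvPolynomial.eval x (h.quadric j k) = 0) ↔
      RingHom.ker (MvPolynomial.aeval h.poly : MvPolynomial Idx ℂ →ₐ[ℂ] ℂ[X])
        ≤ RingHom.ker (MvPolynomial.aeval x : MvPolynomial Idx ℂ →ₐ[ℂ] ℂ) := by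
  rw [← hc.quadricIdeal_eq_ker, quadricIdeal, Ideal.span_le]
  constructor
  · rintro hx _ ⟨j, k, rfl⟩
    exact hx j k
  · exact fun hx j k => hx ⟨j, k, rfl⟩

/-- The zeros of the quadrics are the `ℂ`-algebra homomorphisms from `ℂ[p₃(z), p₄(z), …]` to `ℂ`. As
`ℂ[z]` is integral over this subalgebra, they all extend to evaluations of `ℂ[z]`. -/
theorem zeroLocus_eq :
    {x : Idx → ℂ | ∀ j k : Idx, MvPolynomial.eval x (h.quadric j k) = 0} =
      Set.range (fun (t : ℂ) (j : Idx) => (h.poly j).eval t) := by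
  ext x
  rw [Set.mem_ofPred_eq, hc.eval_quadric_eq_zero_iff]
  constructor
  · intro hker
    have hmonic : (MvPolynomial.aeval h.poly (MvPolynomial.X i3 : MvPolynomial Idx ℂ)).Monic := by
      rw [MvPolynomial.aeval_X]
      exact h.monic_poly i3
    obtain ⟨t, ht⟩ := exists_eval_eq_of_isIntegral
      (isIntegral_of_monic hmonic (by simp [natDegree_poly, i3])) hker
    exact ⟨t, funext fun j => by simpa using (ht (MvPolynomial.X j)).symm⟩
  · rintro ⟨t, rfl⟩ f hf
    have heval := MvPolynomial.comp_aeval_apply h.poly (Polynomial.aeval t) f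
    rw [RingHom.mem_ker.mp hf, map_zero] at heval
    exact heval.symm

end Constraints

end Params

/-! ### The plane curve -/

section NSCurve

variable {n s : ℕ} {F : MvPolynomial (Fin 2) ℂ}

/-- The span of the monomials `x^i y^j` with `n i + s j < n s`, which may be added to `y^n - x^s` in
the equation of an `(n, s)` curve. -/
def lowWeight (n s : ℕ) : Submodule ℂ (MvPolynomial (Fin 2) ℂ) :=
  MvPolynomial.restrictSupport ℂ {m | n * m 0 + s * m 1 < n * s}

theorem C_mul_X_pow_mul_X_pow_mem_lowWeight (e : ℂ) {i j : ℕ} (hij : n * i + s * j < n * s) :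
    MvPolynomial.C e * (MvPolynomial.X 0 ^ i * MvPolynomial.X 1 ^ j) ∈ lowWeight n s := by
  intro m hm
  rw [MvPolynomial.X_pow_eq_monomial, MvPolynomial.X_pow_eq_monomial, MvPolynomial.monomial_mul,
    MvPolynomial.C_mul_monomial] at hm
  obtain rfl := Finset.mem_singleton.mp (MvPolynomial.support_monomial_subset hm)
  simpa using hij

theorem IsNSCurve.exists_bivariateEquiv_neg (hF : IsNSCurve n s F) (hs : 0 < s) :
    ∃ r : ℂ[X][X], r.degree < s ∧ bivariateEquiv ℂ (-F) = X ^ s + r := by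
  set G := F - (MvPolynomial.X 1 ^ n - MvPolynomial.X 0 ^ s) with hG
  have hdeg : (bivariateEquiv ℂ G).degree < s := degree_bivariateEquiv_lt fun m hm =>
    lt_of_mul_lt_mul_left' ((Nat.le_add_right _ _).trans_lt (hF.2 m hm))
  refine ⟨-(C (X ^ n) + bivariateEquiv ℂ G), ?_, ?_⟩
  · rw [degree_neg]
    exact (degree_add_le _ _).trans_lt
      (max_lt (degree_C_le.trans_lt (by exact_mod_cast hs)) hdeg)
  · simp only [hG, map_neg, map_sub, map_pow, bivariateEquiv_X_zero, bivariateEquiv_X_one]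
    ring

theorem IsNSCurve.ker_aeval_eq_span (hF : IsNSCurve n s F) (hs : 0 < s) {p q : ℂ[X]}
    (hp : p.natDegree = n) (hq : q.natDegree = s) (h0 : MvPolynomial.aeval ![p, q] F = 0) :
    RingHom.ker (MvPolynomial.aeval ![p, q] : MvPolynomial (Fin 2) ℂ →ₐ[ℂ] ℂ[X])
      = Ideal.span {F} := by
  obtain ⟨r, hr, hFr⟩ := hF.exists_bivariateEquiv_neg hs
  rw [← Ideal.span_singleton_neg]
  refine ker_aeval_pair_eq_span (by rw [hp, hq]; exact hF.1) (hq ▸ hs) ?_ ?_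
    (by rw [map_neg, h0, neg_zero])
  · exact hFr ▸ monic_X_pow_add hr
  · rw [hFr, natDegree_add_eq_left_of_degree_lt (by rwa [degree_X_pow]), natDegree_X_pow, hq]

end NSCurve

namespace Params

section Curve

variable (h : Params)

/-- The parametrisation `z ↦ (p₃(z), p₄(z))` of the plane curve, on coordinate rings. -/
def param : MvPolynomial (Fin 2) ℂ →ₐ[ℂ] ℂ[X] := MvPolynomial.aeval ![h.poly i3, h.poly i4]

theorem param_X_zero : h.param (MvPolynomial.X 0) = X ^ 3 + C (h.u i3) * X ^ 2 + C (h.v i3) := by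
  simp [param, poly, i3]

theorem param_X_one : h.param (MvPolynomial.X 1) = X ^ 4 + C (h.u i4) * X ^ 2 + C (h.v i4) := by
  simp [param, poly, i4]

theorem param_C (c : ℂ) : h.param (MvPolynomial.C c) = C c := MvPolynomial.algHom_C ..

theorem isNSCurve_curve : IsNSCurve 3 4 h.curve := by
  let a := h.u i3
  let b := h.v i3
  let c := h.u i4
  let d := h.v i4
  suffices hlow : h.curve - (MvPolynomial.X 1 ^ 3 - MvPolynomial.X 0 ^ 4) ∈ lowWeight 3 4 from
    ⟨by norm_num, fun _ hm => hlow hm⟩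
  let term (e : ℂ) (i j : ℕ) : MvPolynomial (Fin 2) ℂ :=
    MvPolynomial.C e * (MvPolynomial.X 0 ^ i * MvPolynomial.X 1 ^ j)
  have hcurve : h.curve - (MvPolynomial.X 1 ^ 3 - MvPolynomial.X 0 ^ 4) =
      term (4 * a) 1 2 - term (3 * c - 2 * a ^ 2) 2 1 - term (-4 * b + 2 * a * c) 3 0
      - term (3 * d + 4 * b * a + a ^ 4 + a ^ 2 * c) 0 2
      - term (4 * a ^ 2 * b + 8 * a * d - 2 * a * c ^ 2 - 6 * b * c - 2 * a ^ 3 * c) 1 1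
      - term (-3 * d * c + 6 * b ^ 2 - 6 * b * a * c + 2 * a ^ 2 * d + a ^ 2 * c ^ 2 + c ^ 3) 2 0
      - term (-3 * d ^ 2 - 2 * b ^ 2 * a ^ 2 - 2 * a ^ 2 * d * c - 2 * a ^ 4 * d + 3 * b ^ 2 * c
        + 2 * b * a * c ^ 2 - 8 * b * a * d + 2 * b * a ^ 3 * c) 0 1
      - term (-4 * b ^ 3 - 4 * a * d ^ 2 + 6 * b * d * c - 4 * b * d * a ^ 2 + 6 * b ^ 2 * a * c
        + 2 * d * a * c ^ 2 + 2 * d * a ^ 3 * c - 2 * b * a ^ 2 * c ^ 2 - 2 * b * c ^ 3) 1 0 := by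
    simp only [curve, term, map_add, map_sub, map_mul, map_pow, map_neg, map_ofNat, a, b, c, d]
    ring
  rw [hcurve]
  refine sub_mem (sub_mem (sub_mem (sub_mem (sub_mem (sub_mem (sub_mem ?_ ?_) ?_) ?_) ?_) ?_) ?_) ?_
  all_goals exact C_mul_X_pow_mul_X_pow_mem_lowWeight _ (by norm_num)

/-- With `x = p₃ - b` and `y = p₄ - d` one has `(a² + c) z² = y + a x - z x` and
`z² x = z y + a y - c x`. Eliminating `z²` gives `z (x² + (a² + c) y) = β` for the polynomial `β`
in `x, y` below. -/
theorem exists_param_eq_X_mul :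
    ∃ β γ : MvPolynomial (Fin 2) ℂ, h.param γ ≠ 0 ∧ h.param β = X * h.param γ := by
  let x : MvPolynomial (Fin 2) ℂ := MvPolynomial.X 0 - MvPolynomial.C (h.v i3)
  let y : MvPolynomial (Fin 2) ℂ := MvPolynomial.X 1 - MvPolynomial.C (h.v i4)
  let a : MvPolynomial (Fin 2) ℂ := MvPolynomial.C (h.u i3)
  let c : MvPolynomial (Fin 2) ℂ := MvPolynomial.C (h.u i4)
  have hx : h.param x = X ^ 3 + C (h.u i3) * X ^ 2 := by
    simp only [x, map_sub, param_X_zero, param_C, add_sub_cancel_right]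
  have hy : h.param y = X ^ 4 + C (h.u i4) * X ^ 2 := by
    simp only [y, map_sub, param_X_one, param_C, add_sub_cancel_right]
  have hγ : h.param (x ^ 2 + (a ^ 2 + c) * y) = X ^ 6 + C (2 * h.u i3) * X ^ 5
      + C (2 * h.u i3 ^ 2 + h.u i4) * X ^ 4 + C ((h.u i3 ^ 2 + h.u i4) * h.u i4) * X ^ 2 := by
    simp only [a, c, map_add, map_mul, map_pow, map_ofNat, hx, hy, param_C]
    ring
  have hmonic : (h.param (x ^ 2 + (a ^ 2 + c) * y)).Monic := by
    rw [hγ]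
    monicity!
  refine ⟨x * y + a * x ^ 2 - a * (a ^ 2 + c) * y + c * (a ^ 2 + c) * x,
    x ^ 2 + (a ^ 2 + c) * y, hmonic.ne_zero, ?_⟩
  simp only [a, c, map_add, map_sub, map_mul, map_pow, hx, hy, param_C]
  ring

end Curve

namespace Constraints

variable {h : Params} (hc : h.Constraints)

include hc

/-- The nonlinear constraints express `H^4_0` through `a`, `b`, `c` and leave one relation between
these; `F(p₃(z), p₄(z))` is a multiple of that relation. -/
theorem param_curve : h.param h.curve = 0 := by
  have hd : C (h.v i4) = C (h.u i3) ^ 2 * C (h.u i4) + C (h.u i4) ^ 2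
      - 2 * C (h.v i3) * C (h.u i3) := by
    have hC := congrArg (C : ℂ →+* ℂ[X]) hc.2.1
    simp only [map_add, map_sub, map_mul, map_pow, map_zero, map_ofNat] at hC
    linear_combination hC
  have hb : C (h.v i3) ^ 2 - C (h.u i3) ^ 2 * C (h.v i4) - C (h.u i4) * C (h.v i4) = 0 := by
    have hC := congrArg (C : ℂ →+* ℂ[X]) hc.2.2
    simpa only [map_add, map_sub, map_mul, map_pow, map_zero, map_ofNat] using hC
  simp only [curve, map_add, map_sub, map_mul, map_pow, map_neg, map_ofNat, param_X_zero,
    param_X_one, param_C]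
  rw [hd] at hb ⊢
  generalize C (h.u i3) = a at hb ⊢
  generalize C (h.v i3) = b at hb ⊢
  generalize C (h.u i4) = c at hb ⊢
  linear_combination (-a ^ 4 * c + 2 * a ^ 3 * b - 2 * a ^ 2 * c ^ 2 + 2 * a * b * c + b ^ 2
    - c ^ 3) * hb

theorem rename_curve_mem : MvPolynomial.rename ![i3, i4] h.curve ∈ h.quadricIdeal := by
  have hcomp : h.poly ∘ ![i3, i4] = ![h.poly i3, h.poly i4] := by
    funext i
    fin_cases i <;> rfl
  rw [hc.quadricIdeal_eq_ker]
  change MvPolynomial.aeval h.poly (MvPolynomial.rename ![i3, i4] h.curve) = 0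
  rw [MvPolynomial.aeval_rename, hcomp]
  exact hc.param_curve

theorem ker_param_eq_span_curve : RingHom.ker h.param = Ideal.span {h.curve} :=
  h.isNSCurve_curve.ker_aeval_eq_span (by norm_num) (h.natDegree_poly i3)
    (h.natDegree_poly i4) hc.param_curve

theorem isPrime_span_curve : (Ideal.span {h.curve}).IsPrime :=
  hc.ker_param_eq_span_curve ▸ RingHom.ker_isPrime _

theorem genus_curve [(Ideal.span {h.curve}).IsPrime] : genus h.curve = 0 := by
  obtain ⟨β, γ, hγ, hβ⟩ := h.exists_param_eq_X_mul
  have hker := hc.ker_param_eq_span_curve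
  let ψ : MvPolynomial (Fin 2) ℂ ⧸ Ideal.span {h.curve} →ₐ[ℂ] ℂ[X] :=
    Ideal.Quotient.liftₐ _ h.param fun f hf => by rwa [← hker] at hf
  have hψ : Function.Injective ψ :=
    RingHom.lift_injective_of_ker_le_ideal _ _ hker.le
  have hγ0 : Ideal.Quotient.mk (Ideal.span {h.curve}) γ ≠ 0 := fun hzero => by
    rw [Ideal.Quotient.eq_zero_iff_mem, ← hker] at hzero
    exact hγ hzero
  have hz := isRationalGenerator_div_of_parametrisation
    (K := FractionRing (MvPolynomial (Fin 2) ℂ ⧸ Ideal.span {h.curve})) hψ hγ0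
    (β := Ideal.Quotient.mk _ β) hβ
  rw [genus, hz.regularDifferentials_eq_bot]
  exact rank_bot _ _

end Constraints

end Params

end SigmaThree

end

theorem mainTheorem8 :
    -- `W₃` lies in the stratum `Σ₃`
    (∀ W ∈ SigmaThree.W3, ∃ V ∈ SigmaThree.stratum 3, W ≤ V) ∧
    -- the points of `W₃` are the spaces spanned by the polynomials `z^j + H^j_{-2} z² + H^j_0`
    -- with coefficients obeying the constraints, each for exactly one choice of coefficients
    Set.BijOn SigmaThree.Params.space {h | h.Constraints} SigmaThree.W3 ∧
    -- two parameters: `H^3_{-2}` and `H^4_{-2}` are free and determine the rest up to two choices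
    (∀ α γ : ℂ,
      {h : SigmaThree.Params | h.Constraints ∧
        h.u SigmaThree.i3 = α ∧ h.u SigmaThree.i4 = γ}.ncard = 1 ∨
      {h : SigmaThree.Params | h.Constraints ∧
        h.u SigmaThree.i3 = α ∧ h.u SigmaThree.i4 = γ}.ncard = 2) ∧
    ∀ h : SigmaThree.Params, h.Constraints →
      -- infinite-dimensional commutative associative algebra with basis `p_j` and
      -- structure constants `C_{jk}^l`
      LinearIndependent ℂ h.series ∧
      ¬ Module.Finite ℂ h.space ∧
      (∀ j k : SigmaThree.Idx,
        h.series j * h.series k = (h.structConst j k).sum fun l c => c • h.series l) ∧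
      (∀ j k : SigmaThree.Idx, h.structConst j k = h.structConst k j) ∧
      (∀ i j k : SigmaThree.Idx,
        ((h.structConst i j).sum fun s c => c • h.structConst s k) =
          (h.structConst j k).sum fun s c => c • h.structConst i s) ∧
      -- the quadrics generate all relations between the `p_j(z)`
      h.quadricIdeal = RingHom.ker (MvPolynomial.aeval h.poly :
        MvPolynomial SigmaThree.Idx ℂ →ₐ[ℂ] Polynomial ℂ) ∧
      -- the variety defined by the quadrics is the one traced out by the `p_j(z)`
      {x : SigmaThree.Idx → ℂ | ∀ j k : SigmaThree.Idx,
          MvPolynomial.eval x (h.quadric j k) = 0} =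
        Set.range (fun (t : ℂ) (j : SigmaThree.Idx) => (h.poly j).eval t) ∧
      -- the ideal contains the plane (3,4) curve, which is irreducible and has genus zero
      MvPolynomial.rename ![SigmaThree.i3, SigmaThree.i4] h.curve ∈ h.quadricIdeal ∧
      SigmaThree.IsNSCurve 3 4 h.curve ∧
      ∃ _ : (Ideal.span {h.curve}).IsPrime, SigmaThree.genus h.curve = 0 := by
  refine ⟨fun W hW => SigmaThree.exists_stratum_of_mem_W3 hW, SigmaThree.bijOn_space,
    SigmaThree.ncard_constraints, fun h hc => ?_⟩
  have hprime := hc.isPrime_span_curve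
  exact ⟨h.linearIndependent_series, h.not_finite_space, hc.series_mul_series,
    h.structConst_comm, hc.structConst_assoc, hc.quadricIdeal_eq_ker, hc.zeroLocus_eq,
    hc.rename_curve_mem, h.isNSCurve_curve, hprime, hc.genus_curve⟩
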